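/- For positive integers $p, L$, widths $d^{(1)}, d^{(2)}, \dots \in \{1,2,\dots\}\cup\{\infty\}$ and $B>0$, let $\mathcal D^{(1)}$ be the set of functions $x\mapsto \sigma(w^Tx+b)$ on $\mathbb R^p$ with $\|w\|_2\le B$, $b\in\mathbb R$, where $\sigma(u)=1/(1+e^{-u})$. Let $\mathcal D^{(l+1)}$ be the set of functions $\max\bigl(\sum_i w_i f_i,\,0\bigr)$, and let $\mathcal D(B,L)$ for $L\ge 2$ be the set of functions $\sum_i w_i f_i$, where $\sum_i|w_i|\le 1$, the sum has at most $d^{(l)}$ (respectively $d^{(L-1)}$) terms, finitely many if the width is $\infty$, and $f_i\in\mathcal D^{(l)}$ (respectively $f_i\in\mathcal D^{(L-1)}$); put $\mathcal D(B,1)=\mathcal D^{(1)}$. For $0<M_1$ and $M_2$, let $\Theta$ be the set of positive semidefinite $p\times p$ real matrices $\Sigma$ with $\lambda_{\min}(\Sigma)\ge M_1$ and $\lambda_{\max}(\Sigma)\le M_2$. Let $W$ denote the Wasserstein distance of order 1 on $\mathbb R^p$ with the Euclidean norm, $W(P,Q)=\inf \mathbb E\|X-Y\|_2$ over all couplings of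 $P$ and $Q$. **Theorem.** There is an absolute constant $c>0$, and for all $M_1>0$ and $M_2$ there is a constant $C>0$ depending only on $M_1$ and $M_2$, such that the following holds for all $p,n,L\ge 1$, all $\epsilon\ge 0$ and all widths with $2^L\cdot\frac pn+\epsilon^2\le c$. Let $\Sigma^*\in\Theta$, let $P$ be a probability distribution on $\mathbb R^p$ with $W(P,\mathcal N(0,\Sigma^*))\le\epsilon$, let $X_1,\dots,X_n$ be i.i.d. from $P$, and let $\widehat\Sigma$ be a W-GAN estimator, that is, $$\widehat\Sigma\in\operatorname*{argmin}_{\Sigma\in\Theta}\ \sup_{f\in\mathcal D(B,L)}\left\{\frac1n\sum_{i=1}^n f(X_i)-\mathbb E_{Y\sim\mathcal N(0,\Sigma)}f(Y)\right\},\qquad B=\frac1{M_1}.$$ Then, with probability at least $1-e^{-(p+n\epsilon^2)}$, $$\|\widehat\Sigma-\Sigma^*\|_2\le C\left(2^L\sqrt{\frac pn}\ \vee\ \epsilon\right),$$ where $\|\cdot\|_2$ is the spectral norm. -/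

import Mathlib

open MeasureTheory ProbabilityTheory
open scoped ENNReal

namespace WGAN

noncomputable section

/-- `π` is a coupling of `P` and `Q`: its two marginals are `P` and `Q`. -/
def IsCoupling {E : Type*} [MeasurableSpace E] (P Q : Measure E) (π : Measure (E × E)) : Prop :=
  π.map Prod.fst = P ∧ π.map Prod.snd = Q

/-- The Wasserstein distance of order one between two distributions on `ℝ^p` with the Euclidean
norm: the infimum over all couplings of `E ‖X - Y‖`, as an extended nonnegative real. -/
def W1 {p : ℕ} (P Q : Measure (EuclideanSpace ℝ (Fin p))) : ℝ≥0∞ :=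
  ⨅ (π : Measure (EuclideanSpace ℝ (Fin p) × EuclideanSpace ℝ (Fin p)))
    (_ : IsCoupling P Q π), ∫⁻ z, ‖z.1 - z.2‖ₑ ∂π

/-- The nodes of the first layer: `x ↦ σ(⟨w, x⟩ + b)` with `‖w‖₂ ≤ B` and `b ∈ ℝ` arbitrary, where
`σ(u) = 1 / (1 + exp (-u))`. -/
def sigmoidNodes (p : ℕ) (B : ℝ) : Set (EuclideanSpace ℝ (Fin p) → ℝ) :=
  {f | ∃ (w : EuclideanSpace ℝ (Fin p)) (b : ℝ),
    ‖w‖ ≤ B ∧ f = fun x => Real.sigmoid (inner ℝ w x + b)}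

/-- Linear combinations `∑ w_i f_i` of members `f_i` of `F` with `∑ |w_i| ≤ 1` and with at most `d`
terms, where `d` is a positive integer or `∞`. (A weight may be zero, so for finite `d ≥ 1` and
nonempty `F` these are the combinations with exactly `d` terms; for `d = ∞` any finite number of
terms is allowed.) -/
def combos {α : Type*} (d : ℕ∞) (F : Set (α → ℝ)) : Set (α → ℝ) :=
  {g | ∃ (k : ℕ) (w : Fin k → ℝ) (f : Fin k → α → ℝ), (k : ℕ∞) ≤ d ∧ (∀ i, f i ∈ F) ∧
    ∑ i, |w i| ≤ 1 ∧ g = fun x => ∑ i, w i * f i x}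

/-- The nodes of the `l`-th hidden layer, `l = 1, 2, …`, in a network whose `l`-th layer has
width `d l`: sigmoid nodes in layer one, ReLU nodes afterwards. (There is no layer zero.) -/
def hiddenNodes (p : ℕ) (B : ℝ) (d : ℕ → ℕ∞) : ℕ → Set (EuclideanSpace ℝ (Fin p) → ℝ)
  | 0 => ∅
  | 1 => sigmoidNodes p B
  | l + 2 => {f | ∃ g ∈ combos (d (l + 1)) (hiddenNodes p B d (l + 1)), f = fun x => max (g x) 0}

/-- The discriminator class `𝒟(B, L)` of networks with `L` layers and widths `d 1, …, d (L - 1)`: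
the output layer is linear, without an activation. For `L = 1` there is only the sigmoid layer. -/
def discriminators (p : ℕ) (B : ℝ) (d : ℕ → ℕ∞) : ℕ → Set (EuclideanSpace ℝ (Fin p) → ℝ)
  | 0 => ∅
  | 1 => hiddenNodes p B d 1
  | L + 2 => combos (d (L + 1)) (hiddenNodes p B d (L + 1))

/-- The parameter space: positive semidefinite matrices all of whose eigenvalues lie in
`[M₁, M₂]`. -/
def covSpace (p : ℕ) (M₁ M₂ : ℝ) : Set (Matrix (Fin p) (Fin p) ℝ) :=
  {S | S.PosSemidef ∧ ∀ t ∈ spectrum ℝ S, M₁ ≤ t ∧ t ≤ M₂}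

/-- The objective `sup_{f ∈ D} (E_{P_n} f - E_{N(0,S)} f)`, where `P_n` is the empirical distribution
of the data `x 1, …, x n`. (For the classes `𝒟(B, L)` with `L ≥ 1` this is the supremum of a
nonempty bounded set, as all their members take values in `[-1, 1]`.) -/
def objective {p n : ℕ} (D : Set (EuclideanSpace ℝ (Fin p) → ℝ))
    (x : Fin n → EuclideanSpace ℝ (Fin p)) (S : Matrix (Fin p) (Fin p) ℝ) : ℝ :=
  ⨆ f : D, ((∑ i, f.1 (x i)) / n - ∫ y, f.1 y ∂(multivariateGaussian 0 S))

/-- `S` is a W-GAN covariance estimate from the data `x`: it minimizes the objective with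
discriminator class `D` over the parameter space `Θ`. -/
def IsEstimate {p n : ℕ} (D : Set (EuclideanSpace ℝ (Fin p) → ℝ))
    (Θ : Set (Matrix (Fin p) (Fin p) ℝ)) (x : Fin n → EuclideanSpace ℝ (Fin p))
    (S : Matrix (Fin p) (Fin p) ℝ) : Prop :=
  S ∈ Θ ∧ IsMinOn (objective D x) Θ S

/-- The spectral norm of a real square matrix: its operator norm on Euclidean space. -/
def specNorm {p : ℕ} (A : Matrix (Fin p) (Fin p) ℝ) : ℝ :=
  ‖Matrix.toEuclideanCLM (n := Fin p) (𝕜 := ℝ) A‖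

end

end WGAN

namespace WGAN

/-! Let Δ be the largest deviation, over the discriminators, of the empirical means from the means
under N(0, Σ*) (`sampleDev`). The proof bounds the error of the estimator by a multiple of Δ, and Δ
by the rate.

Since Σ* is feasible, the minimal objective is at most Δ, so E_{Σ*} f - E_{Σ̂} f ≤ 2Δ for every
discriminator f. Sigmoid nodes are discriminators at every depth, because ReLU fixes nonnegative
functions. For a unit vector v, the nodes σ(B⟨v, x⟩ ± 1) see only the variance B² vᵀΣv. The mean of
σ(√s Z + 1) decreases in s at a rate bounded below on bounded ranges (`sigmoidMean_separation`), and
the shifts 1 and -1 make the comparison two-sided. Hence the spectral error is at most a constant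
times Δ (`specNorm_sub_le_of_isEstimate`).

Discriminators are bounded by one, so bounded differences concentrate Δ around its mean under P. No
higher moments of P are available, so that mean is moved to a Gaussian sample by coupling coordinate
by coordinate, at a cost proportional to the Lipschitz constant B/4 times the Wasserstein distance
(`integral_sampleDev_le_of_W1`). Under the Gaussian, symmetrization leads to Rademacher averages
(`integral_sampleDev_le`). Combinations with ℓ¹ weights do not increase these, and each ReLU layer
costs a factor two.

What remains is the sigmoid layer with its unbounded shifts b (`radOn_sigmoidNodes_le`). In the
parameter √p·arctan(b/√p), which ranges over an interval of length of order √p, the node at x is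
Lipschitz with constant of order 1 + B²‖x‖²/p. A contraction principle with two independent signs
per sample point, one for ⟨w, x⟩ and one for the shift, linearizes both dependences
(`signAvg_iSup_contraction`). Second moments of sign sums then give √(p/n) times fourth moments of
‖X‖/√p, which are dimension-free for the Gaussian. -/

/-! ### Averages over pairs of random signs -/

/-- The average of `F` over all families of `n` pairs of signs. -/
noncomputable def signAvg : (n : ℕ) → ((Fin n → ℝ × ℝ) → ℝ) → ℝ
  | 0, F => F Fin.elim0
  | n + 1, F =>
      (signAvg n (fun e => F (Fin.cons (1, 1) e)) + signAvg n (fun e => F (Fin.cons (1, -1) e)) +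
        signAvg n (fun e => F (Fin.cons (-1, 1) e)) +
        signAvg n (fun e => F (Fin.cons (-1, -1) e))) / 4

theorem signAvg_add {n : ℕ} (F G : (Fin n → ℝ × ℝ) → ℝ) :
    signAvg n (fun e => F e + G e) = signAvg n F + signAvg n G := by
  induction n with
  | zero => rfl
  | succ n ih => simp only [signAvg, ih]; ring

theorem signAvg_const_mul {n : ℕ} (c : ℝ) (F : (Fin n → ℝ × ℝ) → ℝ) :
    signAvg n (fun e => c * F e) = c * signAvg n F := by
  induction n with
  | zero => rfl
  | succ n ih => simp only [signAvg, ih]; ring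

theorem signAvg_const {n : ℕ} (c : ℝ) : signAvg n (fun _ => c) = c := by
  induction n with
  | zero => rfl
  | succ n ih => simp only [signAvg, ih]; ring

theorem signAvg_neg {n : ℕ} (F : (Fin n → ℝ × ℝ) → ℝ) :
    signAvg n (fun e => F (-e)) = signAvg n F := by
  induction n with
  | zero => simp only [signAvg]; congr 1; ext i <;> exact i.elim0
  | succ n ih =>
    have key : ∀ s : ℝ × ℝ, signAvg n (fun e => F (-(Fin.cons s e : Fin (n + 1) → ℝ × ℝ))) =
        signAvg n (fun e => F (Fin.cons (-s) e)) := by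
      intro s
      rw [← ih (fun e => F (Fin.cons (-s) e))]
      congr 1
      ext e
      congr 1
      funext i
      refine Fin.cases ?_ (fun j => ?_) i <;> simp
    simp only [signAvg, key, Prod.neg_mk, neg_neg]
    ring

theorem signAvg_mono {n : ℕ} {F G : (Fin n → ℝ × ℝ) → ℝ} (h : ∀ e, F e ≤ G e) :
    signAvg n F ≤ signAvg n G := by
  induction n with
  | zero => exact h _
  | succ n ih =>
    simp only [signAvg]
    have := fun s : ℝ × ℝ => ih (fun e => h (Fin.cons s e))
    linarith [this (1, 1), this (1, -1), this (-1, 1), this (-1, -1)]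

/-- The average is at least any lower bound valid at all families of signs. -/
theorem le_signAvg {n : ℕ} {F : (Fin n → ℝ × ℝ) → ℝ} {c : ℝ}
    (h : ∀ e : Fin n → ℝ × ℝ, (∀ i, (e i).1 = 1 ∨ (e i).1 = -1) → c ≤ F e) :
    c ≤ signAvg n F := by
  induction n with
  | zero => exact h _ (fun i => i.elim0)
  | succ n ih =>
    simp only [signAvg]
    have := fun (s : ℝ × ℝ) (hs : s.1 = 1 ∨ s.1 = -1) =>
      ih (F := fun e => F (Fin.cons s e)) (fun e he => h (Fin.cons s e) (fun i => by
        refine Fin.cases ?_ (fun j => ?_) i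
        · simpa using hs
        · simpa using he j))
    linarith [this (1, 1) (by simp), this (1, -1) (by simp), this (-1, 1) (by simp),
      this (-1, -1) (by simp)]

/-- Independent signs are orthogonal, so all cross terms average out. The centre `c` is arbitrary
because the induction absorbs each signed pair into it. -/
theorem signAvg_norm_sq {E : Type*} [NormedAddCommGroup E] [InnerProductSpace ℝ E] {n : ℕ}
    (c : E) (u v : Fin n → E) :
    signAvg n (fun e => ‖c + ∑ i, ((e i).1 • u i + (e i).2 • v i)‖ ^ 2) =
      ‖c‖ ^ 2 + ∑ i, (‖u i‖ ^ 2 + ‖v i‖ ^ 2) := by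
  induction n generalizing c with
  | zero => simp [signAvg]
  | succ n ih =>
    simp only [signAvg, Fin.sum_univ_succ, Fin.cons_zero, Fin.cons_succ, ← add_assoc, ih]
    simp only [one_smul, neg_smul, ← sub_eq_add_neg]
    simp only [← real_inner_self_eq_norm_sq, inner_add_left, inner_add_right, inner_sub_left,
      inner_sub_right]
    ring

theorem integral_signAvg {α : Type*} [MeasurableSpace α] {μ : Measure α} {n : ℕ}
    {F : (Fin n → ℝ × ℝ) → α → ℝ} (h : ∀ e, Integrable (F e) μ) :
    Integrable (fun x => signAvg n (fun e => F e x)) μ ∧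
      ∫ x, signAvg n (fun e => F e x) ∂μ = signAvg n (fun e => ∫ x, F e x ∂μ) := by
  induction n with
  | zero => exact ⟨h _, rfl⟩
  | succ n ih =>
    have := fun s : ℝ × ℝ => ih (F := fun e => F (Fin.cons s e)) (fun e => h _)
    have h1 := this (1, 1)
    have h2 := this (1, -1)
    have h3 := this (-1, 1)
    have h4 := this (-1, -1)
    simp only [signAvg]
    refine ⟨(((h1.1.add h2.1).add h3.1).add h4.1).div_const 4, ?_⟩
    have e1 := integral_add ((h1.1.add h2.1).add h3.1) h4.1
    have e2 := integral_add (h1.1.add h2.1) h3.1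
    have e3 := integral_add h1.1 h2.1
    simp only [Pi.add_apply] at e1 e2 e3
    rw [integral_div, e1, e2, e3, h1.2, h2.2, h3.2, h4.2]

/-! ### The contraction principle with two coordinates -/

theorem bddAbove_range_of_abs_le {ι : Type*} {f : ι → ℝ} {K : ℝ} (h : ∀ t, |f t| ≤ K) :
    BddAbove (Set.range f) :=
  ⟨K, by rintro _ ⟨t, rfl⟩; exact (abs_le.mp (h t)).2⟩

/-- One step of the contraction principle: a function with increments bounded by those of `a` or
of `b` is replaced by a signed sum of `a` and `b`. -/
theorem iSup_contraction_step {ι : Type*} [Nonempty ι] {A φ a b : ι → ℝ} {K : ℝ}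
    (hA : ∀ t, |A t| ≤ K) (ha : ∀ t, |a t| ≤ K) (hb : ∀ t, |b t| ≤ K)
    (h : ∀ t t', |φ t - φ t'| ≤ max |a t - a t'| |b t - b t'|) :
    2 * ((⨆ t, (A t + φ t)) + ⨆ t, (A t - φ t)) ≤
      (⨆ t, (A t + (a t + b t))) + (⨆ t, (A t + (a t - b t))) +
        (⨆ t, (A t + (-a t + b t))) + ⨆ t, (A t + (-a t - b t)) := by
  have bdd : ∀ f : ι → ℝ, (∀ t, |f t| ≤ 2 * K) → BddAbove (Set.range fun t => A t + f t) := by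
    intro f hf
    refine bddAbove_range_of_abs_le (K := 3 * K) fun t => (abs_add_le _ _).trans ?_
    linarith [hA t, hf t]
  have b1 := bdd (fun t => a t + b t) fun t => abs_le.mpr
    ⟨by linarith [abs_le.mp (ha t), abs_le.mp (hb t)],
      by linarith [abs_le.mp (ha t), abs_le.mp (hb t)]⟩
  have b2 := bdd (fun t => a t - b t) fun t => abs_le.mpr
    ⟨by linarith [abs_le.mp (ha t), abs_le.mp (hb t)],
      by linarith [abs_le.mp (ha t), abs_le.mp (hb t)]⟩
  have b3 := bdd (fun t => -a t + b t) fun t => abs_le.mpr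
    ⟨by linarith [abs_le.mp (ha t), abs_le.mp (hb t)],
      by linarith [abs_le.mp (ha t), abs_le.mp (hb t)]⟩
  have b4 := bdd (fun t => -a t - b t) fun t => abs_le.mpr
    ⟨by linarith [abs_le.mp (ha t), abs_le.mp (hb t)],
      by linarith [abs_le.mp (ha t), abs_le.mp (hb t)]⟩
  set S := (⨆ t, (A t + (a t + b t))) + (⨆ t, (A t + (a t - b t))) +
        (⨆ t, (A t + (-a t + b t))) + ⨆ t, (A t + (-a t - b t)) with hS
  -- If the increment of `φ` is dominated by that of `a`, use `t` in the two suprema where `a` has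
  -- one sign and `t'` in the other two: the `b` terms cancel. The case of `b` is symmetric.
  have key : ∀ t t', (A t + φ t) + (A t' - φ t') ≤ S / 2 := by
    intro t t'
    have e1 := le_ciSup b1 t
    have e2 := le_ciSup b2 t
    have e3 := le_ciSup b3 t
    have e4 := le_ciSup b4 t
    have f1 := le_ciSup b1 t'
    have f2 := le_ciSup b2 t'
    have f3 := le_ciSup b3 t'
    have f4 := le_ciSup b4 t'
    have hφ := (le_abs_self _).trans (h t t')
    rcases le_max_iff.mp hφ with hφ | hφ <;> rcases le_abs.mp hφ with hφ | hφ <;> linarith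
  have h1 : (⨆ t, (A t + φ t)) ≤ S / 2 - ⨆ t, (A t - φ t) := by
    refine ciSup_le fun t => ?_
    have : (⨆ t, (A t - φ t)) ≤ S / 2 - (A t + φ t) := ciSup_le fun t' => by linarith [key t t']
    linarith
  linarith

/-- The contraction principle for Rademacher averages, in a two-dimensional version. -/
theorem signAvg_iSup_contraction {ι : Type*} [Nonempty ι] {n : ℕ} {A : ι → ℝ}
    {φ a b : Fin n → ι → ℝ} (hA : ∃ K, ∀ t, |A t| ≤ K) (hφ : ∀ i, ∃ K, ∀ t, |φ i t| ≤ K)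
    (ha : ∀ i, ∃ K, ∀ t, |a i t| ≤ K) (hb : ∀ i, ∃ K, ∀ t, |b i t| ≤ K)
    (h : ∀ i t t', |φ i t - φ i t'| ≤ max |a i t - a i t'| |b i t - b i t'|) :
    signAvg n (fun e => ⨆ t, (A t + ∑ i, (e i).1 * φ i t)) ≤
      signAvg n (fun e => ⨆ t, (A t + ∑ i, ((e i).1 * a i t + (e i).2 * b i t))) := by
  induction n generalizing A with
  | zero => simp [signAvg]
  | succ n ih =>
    have step : ∀ s : ℝ × ℝ,
        signAvg n (fun e => ⨆ t, ((A t + (s.1 * a 0 t + s.2 * b 0 t)) +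
          ∑ i : Fin n, (e i).1 * φ i.succ t)) ≤
        signAvg n (fun e => ⨆ t, ((A t + (s.1 * a 0 t + s.2 * b 0 t)) +
          ∑ i : Fin n, ((e i).1 * a i.succ t + (e i).2 * b i.succ t))) := by
      intro s
      refine ih ?_ (fun i => hφ _) (fun i => ha _) (fun i => hb _) (fun i => h _)
      obtain ⟨K, hK⟩ := hA
      obtain ⟨K1, hK1⟩ := ha 0
      obtain ⟨K2, hK2⟩ := hb 0
      refine ⟨K + (|s.1| * K1 + |s.2| * K2), fun t => (abs_add_le _ _).trans
        (add_le_add (hK t) ((abs_add_le _ _).trans (add_le_add ?_ ?_)))⟩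
      · rw [abs_mul]; exact mul_le_mul_of_nonneg_left (hK1 t) (abs_nonneg _)
      · rw [abs_mul]; exact mul_le_mul_of_nonneg_left (hK2 t) (abs_nonneg _)
    have one : ∀ e : Fin n → ℝ × ℝ,
        2 * ((⨆ t, ((A t + ∑ i : Fin n, (e i).1 * φ i.succ t) + φ 0 t)) +
          ⨆ t, ((A t + ∑ i : Fin n, (e i).1 * φ i.succ t) - φ 0 t)) ≤
        (⨆ t, ((A t + ∑ i : Fin n, (e i).1 * φ i.succ t) + (a 0 t + b 0 t))) +
        (⨆ t, ((A t + ∑ i : Fin n, (e i).1 * φ i.succ t) + (a 0 t - b 0 t))) +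
        (⨆ t, ((A t + ∑ i : Fin n, (e i).1 * φ i.succ t) + (-a 0 t + b 0 t))) +
        ⨆ t, ((A t + ∑ i : Fin n, (e i).1 * φ i.succ t) + (-a 0 t - b 0 t)) := by
      intro e
      obtain ⟨K, hK⟩ := hA
      obtain ⟨K1, hK1⟩ := ha 0
      obtain ⟨K2, hK2⟩ := hb 0
      choose Kφ hKφ using hφ
      refine iSup_contraction_step
        (K := max (K + ∑ i : Fin n, |(e i).1| * Kφ i.succ) (max K1 K2)) (fun t => ?_)
        (fun t => (hK1 t).trans ((le_max_left _ _).trans (le_max_right _ _)))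
        (fun t => (hK2 t).trans ((le_max_right _ _).trans (le_max_right _ _))) (h 0)
      refine le_trans ((abs_add_le _ _).trans (add_le_add (hK t) ?_)) (le_max_left _ _)
      refine (Finset.abs_sum_le_sum_abs _ _).trans (Finset.sum_le_sum fun i _ => ?_)
      rw [abs_mul]
      exact mul_le_mul_of_nonneg_left (hKφ _ t) (abs_nonneg _)
    have mono := signAvg_mono one
    simp only [signAvg_const_mul, signAvg_add] at mono
    have s1 := step (1, 1)
    have s2 := step (1, -1)
    have s3 := step (-1, 1)
    have s4 := step (-1, -1)
    simp only [signAvg, Fin.sum_univ_succ, Fin.cons_zero, Fin.cons_succ]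
    simp only [one_mul, neg_one_mul, ← sub_eq_add_neg, add_sub_right_comm, add_right_comm _ _
      (Finset.sum _ _), ← add_assoc] at mono s1 s2 s3 s4 ⊢
    linarith

/-! ### Rademacher averages under combinations and ReLU -/

/-- The unnormalized Rademacher average of a family of vectors. -/
noncomputable def rad {ι : Type*} {n : ℕ} (v : ι → Fin n → ℝ) : ℝ :=
  signAvg n (fun e => ⨆ t, |∑ i, (e i).1 * v t i|)

theorem abs_sum_mul_le {n : ℕ} (c v : Fin n → ℝ) (hv : ∀ i, |v i| ≤ 1) :
    |∑ i, c i * v i| ≤ ∑ i, |c i| := by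
  refine (Finset.abs_sum_le_sum_abs _ _).trans (Finset.sum_le_sum fun i _ => ?_)
  rw [abs_mul]
  exact mul_le_of_le_one_right (abs_nonneg _) (hv i)

theorem bddAbove_abs_sum {ι : Type*} {n : ℕ} {v : ι → Fin n → ℝ} (hv : ∀ t i, |v t i| ≤ 1)
    (c : Fin n → ℝ) : BddAbove (Set.range fun t => |∑ i, c i * v t i|) :=
  bddAbove_range_of_abs_le (K := ∑ i, |c i|) fun t => by
    rw [abs_abs]; exact abs_sum_mul_le c (v t) (hv t)

theorem rad_le_rad {ι κ : Type*} [Nonempty ι] {n : ℕ} {v : ι → Fin n → ℝ} {v' : κ → Fin n → ℝ}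
    (hv' : ∀ t i, |v' t i| ≤ 1) (h : ∀ t, ∃ s, v t = v' s) : rad v ≤ rad v' := by
  refine signAvg_mono fun e => ciSup_le fun t => ?_
  obtain ⟨s, hs⟩ := h t
  rw [hs]
  exact le_ciSup (bddAbove_abs_sum hv' fun i => (e i).1) s

/-- Removes the absolute value: |X_t| ≤ |X_{t₀}| + sup X + sup(-X), and the two suprema have the
same average by sign symmetry. This is the source of the factor two per layer. -/
theorem rad_le_of_base {ι : Type*} {n : ℕ} {v : ι → Fin n → ℝ}
    (hv : ∀ t i, |v t i| ≤ 1) (t₀ : ι) :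
    rad v ≤ signAvg n (fun e => |∑ i, (e i).1 * v t₀ i|) +
      2 * signAvg n (fun e => ⨆ t, ∑ i, (e i).1 * v t i) := by
  have : Nonempty ι := ⟨t₀⟩
  have hneg := signAvg_neg (fun e : Fin n → ℝ × ℝ => ⨆ t, ∑ i, (e i).1 * v t i)
  have hbdd : ∀ c : Fin n → ℝ, BddAbove (Set.range fun t => ∑ i, c i * v t i) := fun c =>
    bddAbove_range_of_abs_le (K := ∑ i, |c i|) fun t => abs_sum_mul_le c (v t) (hv t)
  rw [two_mul, ← add_assoc]
  nth_rewrite 2 [← hneg]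
  rw [← signAvg_add, ← signAvg_add]
  refine signAvg_mono fun e => ciSup_le fun t => ?_
  have h1 := hbdd (fun i => (e i).1)
  have h2 := hbdd (fun i => ((-e) i).1)
  have a1 := le_ciSup h1 t
  have a2 := le_ciSup h1 t₀
  have b1 := le_ciSup h2 t
  have b2 := le_ciSup h2 t₀
  have hs : ∀ t, ∑ i, ((-e) i).1 * v t i = -∑ i, (e i).1 * v t i := by
    intro t; rw [← Finset.sum_neg_distrib]; simp
  simp only [hs] at b1 b2 ⊢
  rcases abs_cases (∑ i, (e i).1 * v t i) with h | h <;>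
    rcases abs_cases (∑ i, (e i).1 * v t₀ i) with h' | h' <;> linarith

/-- ReLU is 1-Lipschitz, so contraction applies with a trivial second coordinate. The family
vanishing on the sample makes the base term zero. -/
theorem rad_max_zero_le {ι : Type*} {n : ℕ} {v : ι → Fin n → ℝ}
    (hv : ∀ t i, |v t i| ≤ 1) (t₀ : ι) (h₀ : ∀ i, v t₀ i = 0) :
    rad (fun t i => max (v t i) 0) ≤ 2 * rad v := by
  have : Nonempty ι := ⟨t₀⟩
  have hm : ∀ t i, |max (v t i) 0| ≤ 1 := fun t i => by
    have := abs_le.mp (hv t i)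
    rw [abs_of_nonneg (le_max_right _ _)]
    exact max_le this.2 zero_le_one
  refine (rad_le_of_base hm t₀).trans ?_
  have hz : signAvg n (fun e => |∑ i, (e i).1 * max (v t₀ i) 0|) = 0 := by
    simp [h₀, signAvg_const]
  rw [hz, zero_add]
  refine mul_le_mul_of_nonneg_left ?_ zero_le_two
  have := signAvg_iSup_contraction (n := n) (A := fun _ : ι => (0 : ℝ))
    (φ := fun i t => max (v t i) 0) (a := fun i t => v t i) (b := fun _ _ => 0)
    ⟨0, by simp⟩ (fun i => ⟨1, fun t => hm t i⟩) (fun i => ⟨1, fun t => hv t i⟩)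
    (fun i => ⟨0, by simp⟩)
    (fun i t t' => le_max_of_le_left (abs_max_sub_max_le_abs _ _ _))
  simp only [zero_add, mul_zero, add_zero] at this
  refine this.trans (signAvg_mono fun e => ciSup_le fun t => ?_)
  exact (le_abs_self _).trans (le_ciSup (bddAbove_abs_sum hv fun i => (e i).1) t)

/-- The Rademacher average of a class of functions on a sample. -/
noncomputable def radOn {α : Type*} {n : ℕ} (F : Set (α → ℝ)) (x : Fin n → α) : ℝ :=
  rad (fun (f : F) i => f.1 (x i))

/-- The empty sum is allowed at every width; it is the base point needed for the ReLU contraction.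
-/
theorem zero_mem_combos {α : Type*} (d : ℕ∞) (F : Set (α → ℝ)) : (fun _ => 0) ∈ combos d F :=
  ⟨0, Fin.elim0, Fin.elim0, by simp, fun i => i.elim0, by simp, by simp⟩

/-- A signed sum is linear in the function, so on the ℓ¹ ball it is bounded by its supremum over the
generators. -/
theorem radOn_combos_le {α : Type*} {n : ℕ} {d : ℕ∞} {F : Set (α → ℝ)} (x : Fin n → α)
    (hF : ∀ f ∈ F, ∀ y, |f y| ≤ 1) : radOn (combos d F) x ≤ radOn F x := by
  have : Nonempty (combos d F) := ⟨⟨_, zero_mem_combos d F⟩⟩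
  refine signAvg_mono fun e => ciSup_le ?_
  rintro ⟨g, k, w, f, -, hf, hw, rfl⟩
  have hbdd := bddAbove_abs_sum (v := fun (f : F) i => f.1 (x i)) (fun f i => hF f.1 f.2 _)
    (fun i => (e i).1)
  set R := ⨆ f : F, |∑ i, (e i).1 * f.1 (x i)| with hR
  have hR0 : 0 ≤ R := Real.iSup_nonneg fun _ => abs_nonneg _
  have hswap : ∑ i, (e i).1 * ∑ j, w j * f j (x i) = ∑ j, w j * ∑ i, (e i).1 * f j (x i) := by
    simp only [Finset.mul_sum]
    rw [Finset.sum_comm]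
    exact Finset.sum_congr rfl fun j _ => Finset.sum_congr rfl fun i _ => by ring
  simp only [hswap]
  calc |∑ j, w j * ∑ i, (e i).1 * f j (x i)| ≤ ∑ j, |w j| * R := by
        refine (Finset.abs_sum_le_sum_abs _ _).trans (Finset.sum_le_sum fun j _ => ?_)
        rw [abs_mul]
        exact mul_le_mul_of_nonneg_left (le_ciSup hbdd ⟨f j, hf j⟩) (abs_nonneg _)
    _ = (∑ j, |w j|) * R := by rw [Finset.sum_mul]
    _ ≤ R := mul_le_of_le_one_left hR0 hw

/-! ### Bounded Lipschitz functions and the derivative of the sigmoid -/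

/-- The functions bounded by one with Lipschitz constant `K`. -/
def boundedLip (p : ℕ) (K : ℝ) : Set (EuclideanSpace ℝ (Fin p) → ℝ) :=
  {f | (∀ x, |f x| ≤ 1) ∧ ∀ x y, |f x - f y| ≤ K * ‖x - y‖}

theorem combos_subset_boundedLip {p : ℕ} {K : ℝ} (hK : 0 ≤ K) {d : ℕ∞}
    {F : Set (EuclideanSpace ℝ (Fin p) → ℝ)} (hF : F ⊆ boundedLip p K) :
    combos d F ⊆ boundedLip p K := by
  rintro _ ⟨k, w, f, -, hf, hw, rfl⟩
  have key : ∀ (u : Fin k → ℝ) (R : ℝ), 0 ≤ R → (∀ i, |u i| ≤ R) → |∑ i, w i * u i| ≤ R := by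
    intro u R hR hu
    calc |∑ i, w i * u i| ≤ ∑ i, |w i| * R := by
          refine (Finset.abs_sum_le_sum_abs _ _).trans (Finset.sum_le_sum fun j _ => ?_)
          rw [abs_mul]
          exact mul_le_mul_of_nonneg_left (hu j) (abs_nonneg _)
      _ = (∑ i, |w i|) * R := by rw [Finset.sum_mul]
      _ ≤ R := mul_le_of_le_one_left hR hw
  refine ⟨fun x => key _ 1 zero_le_one fun i => (hF (hf i)).1 x, fun x y => ?_⟩
  simp only [← Finset.sum_sub_distrib, ← mul_sub]
  exact key (fun i => f i x - f i y) _ (by positivity) fun i => (hF (hf i)).2 x y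

theorem max_zero_mem_boundedLip {p : ℕ} {K : ℝ} {f : EuclideanSpace ℝ (Fin p) → ℝ}
    (hf : f ∈ boundedLip p K) : (fun x => max (f x) 0) ∈ boundedLip p K := by
  refine ⟨fun x => ?_, fun x y => (abs_max_sub_max_le_abs _ _ _).trans (hf.2 x y)⟩
  rw [abs_of_nonneg (le_max_right _ _)]
  exact max_le (abs_le.mp (hf.1 x)).2 zero_le_one

theorem sigmoid_mul_one_sub (s : ℝ) :
    Real.sigmoid s * (1 - Real.sigmoid s) = 1 / (2 + 2 * Real.cosh s) := by
  rw [← Real.sigmoid_neg, Real.sigmoid_def, Real.sigmoid_def, Real.cosh_eq, neg_neg,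
    ← mul_inv, one_div]
  congr 1
  have : Real.exp (-s) * Real.exp s = 1 := by rw [← Real.exp_add]; simp
  linear_combination this

/-- With `sigmoid_mul_one_sub` this gives σ'(s) ≤ 1/(4 + s²), a decay comparable with the derivative
of the arctangent. -/
theorem one_add_sq_div_two_le_cosh (s : ℝ) : 1 + s ^ 2 / 2 ≤ Real.cosh s := by
  have h : Real.cosh s = 1 + 2 * Real.sinh (s / 2) ^ 2 := by
    have h1 := Real.cosh_two_mul (s / 2)
    have h2 := Real.cosh_sq (s / 2)
    rw [mul_div_cancel₀ _ two_ne_zero] at h1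
    linarith
  have h2 : (s / 2) ^ 2 ≤ Real.sinh (s / 2) ^ 2 := by
    rw [← sq_abs, ← sq_abs (Real.sinh _), Real.abs_sinh]
    exact pow_le_pow_left₀ (abs_nonneg _) (Real.self_le_sinh_iff.mpr (abs_nonneg _)) 2
  rw [h]; linarith

/-- A differentiable function whose derivative is dominated by that of a monotone one. -/
theorem abs_sub_le_of_hasDerivAt_le {f g f' g' : ℝ → ℝ} (hf : ∀ x, HasDerivAt f (f' x) x)
    (hg : ∀ x, HasDerivAt g (g' x) x) (h0 : ∀ x, 0 ≤ f' x) (h : ∀ x, f' x ≤ g' x) (a b : ℝ) :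
    |f a - f b| ≤ |g a - g b| := by
  have hf1 : Monotone f := monotone_of_hasDerivAt_nonneg hf h0
  have hg1 : Monotone (fun x => g x - f x) :=
    monotone_of_hasDerivAt_nonneg (fun x => (hg x).sub (hf x)) fun x => sub_nonneg.mpr (h x)
  rcases le_total a b with hab | hab
  · have h1 := hf1 hab
    have h2 := hg1 hab
    simp only at h2
    rw [abs_of_nonpos (by linarith), abs_of_nonpos (by linarith)]
    linarith
  · have h1 := hf1 hab
    have h2 := hg1 hab
    simp only at h2
    rw [abs_of_nonneg (by linarith), abs_of_nonneg (by linarith)]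
    linarith

theorem sigmoid_deriv_nonneg (s : ℝ) : 0 ≤ Real.sigmoid s * (1 - Real.sigmoid s) :=
  mul_nonneg (Real.sigmoid_nonneg s) (sub_nonneg.mpr (Real.sigmoid_le_one s))

theorem abs_sigmoid_sub_le (u v : ℝ) : |Real.sigmoid u - Real.sigmoid v| ≤ |u - v| / 4 := by
  have := abs_sub_le_of_hasDerivAt_le (g := fun x => x / 4) (g' := fun _ => 1 / 4)
    Real.hasDerivAt_sigmoid (fun x => (hasDerivAt_id x).div_const 4) sigmoid_deriv_nonneg
    (fun x => ?_) u v
  · rwa [← sub_div, abs_div, abs_of_pos (four_pos : (0 : ℝ) < 4)] at this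
  · nlinarith [sq_nonneg (Real.sigmoid x - 1 / 2)]

/-- Shifts of the sigmoid are Lipschitz in a bounded reparametrization of the shift. -/
theorem abs_sigmoid_shift_sub_le {K U u : ℝ} (hK : 1 ≤ K) (hu : |u| ≤ U) (b b' : ℝ) :
    |Real.sigmoid (u + b) - Real.sigmoid (u + b')| ≤
      (3 + U ^ 2 / K ^ 2) * |K * Real.arctan (b / K) - K * Real.arctan (b' / K)| := by
  have hK0 : 0 < K := by linarith
  have hU : 0 ≤ 3 + U ^ 2 / K ^ 2 := by positivity
  have := abs_sub_le_of_hasDerivAt_le (f := fun b => Real.sigmoid (u + b))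
    (f' := fun b => Real.sigmoid (u + b) * (1 - Real.sigmoid (u + b)))
    -- The map b ↦ K·arctan(b/K) compresses all shifts into an interval of length πK; its derivative
    -- K²/(K² + b²) still dominates σ'(u + b), up to a bounded factor when |u| = O(K).
    (g := fun b => (3 + U ^ 2 / K ^ 2) * (K * Real.arctan (b / K)))
    (g' := fun b => (3 + U ^ 2 / K ^ 2) * (K * (1 / (1 + (b / K) ^ 2) * (1 / K))))
    (fun x => (Real.hasDerivAt_sigmoid (u + x)).comp_const_add u x)
    (fun x => (((hasDerivAt_id x).div_const K).arctan.const_mul K).const_mul _)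
    (fun x => sigmoid_deriv_nonneg _) (fun x => ?_) b b'
  · rwa [← mul_sub, abs_mul, abs_of_nonneg hU] at this
  · rw [sigmoid_mul_one_sub]
    have hc := one_add_sq_div_two_le_cosh (u + x)
    have hu2 : u ^ 2 ≤ U ^ 2 := sq_le_sq' (by linarith [abs_le.mp hu]) (abs_le.mp hu).2
    have e1 : (3 + U ^ 2 / K ^ 2) * (K * (1 / (1 + (x / K) ^ 2) * (1 / K))) =
        (3 * K ^ 2 + U ^ 2) / (K ^ 2 + x ^ 2) := by
      field_simp
    rw [e1, div_le_div_iff₀ (by linarith [sq_nonneg (u + x)]) (by positivity), one_mul]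
    have hK2 : 1 ≤ K ^ 2 := one_le_pow₀ hK
    have h3 : x ^ 2 ≤ 2 * (u + x) ^ 2 + 2 * u ^ 2 := by nlinarith [sq_nonneg (2 * u + x)]
    have h4 : (3 * K ^ 2 + U ^ 2) * (4 + (u + x) ^ 2) ≤
        (3 * K ^ 2 + U ^ 2) * (2 + 2 * Real.cosh (u + x)) :=
      mul_le_mul_of_nonneg_left (by linarith) (by positivity)
    have h5 : (u + x) ^ 2 ≤ K ^ 2 * (u + x) ^ 2 := le_mul_of_one_le_left (sq_nonneg _) hK2
    have h6 : 0 ≤ U ^ 2 * (u + x) ^ 2 := by positivity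
    nlinarith

/-! ### The network classes, layer by layer -/

theorem sigmoidNodes_subset_boundedLip (p : ℕ) (B : ℝ) :
    sigmoidNodes p B ⊆ boundedLip p (B / 4) := by
  rintro _ ⟨w, b, hw, rfl⟩
  refine ⟨fun x => ?_, fun x y => ?_⟩
  · rw [abs_of_nonneg (Real.sigmoid_nonneg _)]; exact Real.sigmoid_le_one _
  · refine (abs_sigmoid_sub_le _ _).trans ?_
    rw [add_sub_add_right_eq_sub, ← inner_sub_right, div_mul_eq_mul_div]
    gcongr
    exact (abs_real_inner_le_norm _ _).trans (mul_le_mul_of_nonneg_right hw (norm_nonneg _))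

theorem hiddenNodes_subset_boundedLip {p : ℕ} {B : ℝ} (hB : 0 ≤ B) (d : ℕ → ℕ∞) (l : ℕ) :
    hiddenNodes p B d (l + 1) ⊆ boundedLip p (B / 4) := by
  induction l with
  | zero => exact sigmoidNodes_subset_boundedLip p B
  | succ l ih =>
    rintro _ ⟨g, hg, rfl⟩
    exact max_zero_mem_boundedLip (combos_subset_boundedLip (by positivity) ih hg)

theorem discriminators_subset_boundedLip {p : ℕ} {B : ℝ} (hB : 0 ≤ B) (d : ℕ → ℕ∞) (L : ℕ) :
    discriminators p B d (L + 1) ⊆ boundedLip p (B / 4) := by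
  cases L with
  | zero => exact hiddenNodes_subset_boundedLip hB d 0
  | succ L =>
    exact combos_subset_boundedLip (by positivity) (hiddenNodes_subset_boundedLip hB d L)

theorem mem_combos_of_mem {α : Type*} {d : ℕ∞} (hd : 1 ≤ d) {F : Set (α → ℝ)} {f : α → ℝ}
    (hf : f ∈ F) : f ∈ combos d F :=
  ⟨1, fun _ => 1, fun _ => f, by simpa using hd, fun _ => hf, by simp, by simp⟩

theorem sigmoidNodes_subset_hiddenNodes {p : ℕ} {B : ℝ} {d : ℕ → ℕ∞} (hd : ∀ l, 1 ≤ d l)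
    (l : ℕ) : sigmoidNodes p B ⊆ hiddenNodes p B d (l + 1) := by
  induction l with
  | zero => exact subset_rfl
  | succ l ih =>
    intro f hf
    refine ⟨f, mem_combos_of_mem (hd _) (ih hf), ?_⟩
    obtain ⟨w, b, -, rfl⟩ := hf
    funext x
    rw [max_eq_left (Real.sigmoid_nonneg _)]

theorem sigmoidNodes_subset_discriminators {p : ℕ} {B : ℝ} {d : ℕ → ℕ∞} (hd : ∀ l, 1 ≤ d l)
    (L : ℕ) : sigmoidNodes p B ⊆ discriminators p B d (L + 1) := by
  cases L with
  | zero => exact subset_rfl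
  | succ L => exact fun f hf => mem_combos_of_mem (hd _) (sigmoidNodes_subset_hiddenNodes hd L hf)

theorem radOn_hiddenNodes_le {p n : ℕ} {B : ℝ} (hB : 0 ≤ B) (d : ℕ → ℕ∞) (l : ℕ)
    (x : Fin n → EuclideanSpace ℝ (Fin p)) :
    radOn (hiddenNodes p B d (l + 1)) x ≤ 2 ^ l * radOn (sigmoidNodes p B) x := by
  induction l with
  | zero => rw [pow_zero, one_mul]; rfl
  | succ l ih =>
    have hb : hiddenNodes p B d (l + 1) ⊆ boundedLip p (B / 4) :=
      hiddenNodes_subset_boundedLip hB d l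
    have hc : combos (d (l + 1)) (hiddenNodes p B d (l + 1)) ⊆ boundedLip p (B / 4) :=
      combos_subset_boundedLip (by positivity) hb
    let v : combos (d (l + 1)) (hiddenNodes p B d (l + 1)) → Fin n → ℝ := fun g i => g.1 (x i)
    have h1 : radOn (hiddenNodes p B d (l + 2)) x ≤ rad (fun t i => max (v t i) 0) := by
      have : Nonempty (hiddenNodes p B d (l + 2)) := ⟨⟨_, _, zero_mem_combos _ _, rfl⟩⟩
      refine rad_le_rad (fun t i => (max_zero_mem_boundedLip (hc t.2)).1 _) ?_
      rintro ⟨_, g, hg, rfl⟩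
      exact ⟨⟨g, hg⟩, rfl⟩
    have h2 : rad (fun t i => max (v t i) 0) ≤ 2 * rad v :=
      rad_max_zero_le (fun t i => (hc t.2).1 _) ⟨_, zero_mem_combos _ _⟩ fun i => rfl
    have h3 : rad v ≤ radOn (hiddenNodes p B d (l + 1)) x :=
      radOn_combos_le x fun f hf => (hb hf).1
    rw [pow_succ]
    linarith

theorem radOn_discriminators_le {p n : ℕ} {B : ℝ} (hB : 0 ≤ B) (d : ℕ → ℕ∞) (L : ℕ)
    (x : Fin n → EuclideanSpace ℝ (Fin p)) (h0 : 0 ≤ radOn (sigmoidNodes p B) x) :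
    radOn (discriminators p B d (L + 1)) x ≤ 2 ^ L * radOn (sigmoidNodes p B) x := by
  cases L with
  | zero => rw [pow_zero, one_mul]; rfl
  | succ L =>
    refine (radOn_combos_le x fun f hf => (hiddenNodes_subset_boundedLip hB d L hf).1).trans
      ((radOn_hiddenNodes_le hB d L x).trans ?_)
    -- The output layer has no ReLU, so a factor two is given away here to have one bound for all
    -- depths.
    exact mul_le_mul_of_nonneg_right (pow_le_pow_right₀ one_le_two L.le_succ) h0

/-! ### The Rademacher average of the sigmoid layer -/

theorem rad_nonneg {ι : Type*} {n : ℕ} (v : ι → Fin n → ℝ) : 0 ≤ rad v :=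
  le_signAvg fun _ _ => Real.iSup_nonneg fun _ => abs_nonneg _

/-- From z ≤ (z²/s + s)/2. In place of the square root from Jensen's inequality this yields a bound
linear in the squared norms, which can be integrated over the sample directly. -/
theorem signAvg_norm_le {E : Type*} [NormedAddCommGroup E] [InnerProductSpace ℝ E] {n : ℕ}
    (u v : Fin n → E) {s : ℝ} (hs : 0 < s) :
    signAvg n (fun e => ‖∑ i, ((e i).1 • u i + (e i).2 • v i)‖) ≤
      ((∑ i, (‖u i‖ ^ 2 + ‖v i‖ ^ 2)) / s + s) / 2 := by
  have h : ∀ e : Fin n → ℝ × ℝ, ‖∑ i, ((e i).1 • u i + (e i).2 • v i)‖ ≤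
      (1 / (2 * s)) * ‖0 + ∑ i, ((e i).1 • u i + (e i).2 • v i)‖ ^ 2 + s / 2 := by
    intro e
    rw [zero_add]
    set z := ‖∑ i, ((e i).1 • u i + (e i).2 • v i)‖
    have : (1 / (2 * s)) * z ^ 2 + s / 2 - z = (z - s) ^ 2 / (2 * s) := by field_simp; ring
    have h2 : 0 ≤ (z - s) ^ 2 / (2 * s) := by positivity
    linarith
  refine (signAvg_mono h).trans (le_of_eq ?_)
  rw [signAvg_add, signAvg_const_mul, signAvg_norm_sq, signAvg_const, norm_zero]
  field_simp
  ring

theorem sq_le_of_le_pow_four {a p : ℝ} (hp : 0 < p) : a ^ 2 ≤ (a ^ 4 / p + p) / 2 := by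
  have : (a ^ 4 / p + p) / 2 - a ^ 2 = (a ^ 2 - p) ^ 2 / (2 * p) := by field_simp; ring
  have h2 : 0 ≤ (a ^ 2 - p) ^ 2 / (2 * p) := by positivity
  linarith

/-- The Rademacher average of the sigmoid nodes, with unbounded shifts, in terms of the fourth
moments of the sample. -/
theorem radOn_sigmoidNodes_le {p n : ℕ} (hp : 1 ≤ p) (hn : 1 ≤ n) {B : ℝ} (hB : 0 ≤ B)
    (x : Fin n → EuclideanSpace ℝ (Fin p)) :
    radOn (sigmoidNodes p B) x ≤ √(p / n) *
      ((77 + B) * n + (B + 8 * B ^ 4) * ∑ i, ‖x i‖ ^ 4 / (p : ℝ) ^ 2) := by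
  have hp1 : (1 : ℝ) ≤ p := by exact_mod_cast hp
  have hn1 : (1 : ℝ) ≤ n := by exact_mod_cast hn
  set a := √(p : ℝ) with ha
  set r := √(n : ℝ) with hr
  have ha2 : a ^ 2 = p := Real.sq_sqrt (by positivity)
  have hr2 : r ^ 2 = n := Real.sq_sqrt (by positivity)
  have ha1 : 1 ≤ a := Real.one_le_sqrt.mpr hp1
  have hr1 : 1 ≤ r := Real.one_le_sqrt.mpr hn1
  have ha0 : 0 < a := by linarith
  have hr0 : 0 < r := by linarith
  have hsq : √((p : ℝ) / n) = a / r := Real.sqrt_div (by positivity) _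
  let ι := {w : EuclideanSpace ℝ (Fin p) // ‖w‖ ≤ B} × ℝ
  let t₀ : ι := (⟨0, by simpa using hB⟩, 0)
  have : Nonempty ι := ⟨t₀⟩
  let v : ι → Fin n → ℝ := fun t i => Real.sigmoid (inner ℝ t.1.1 (x i) + t.2)
  have hv : ∀ t i, |v t i| ≤ 1 := fun t i => by
    rw [abs_of_nonneg (Real.sigmoid_nonneg _)]; exact Real.sigmoid_le_one _
  have hιv : radOn (sigmoidNodes p B) x ≤ rad v := by
    have : Nonempty (sigmoidNodes p B) := ⟨⟨_, t₀.1.1, t₀.2, t₀.1.2, rfl⟩⟩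
    refine rad_le_rad hv ?_
    rintro ⟨_, w, b, hw, rfl⟩
    exact ⟨(⟨w, hw⟩, b), rfl⟩
  have hbase := rad_le_of_base hv t₀
  -- the constant function
  have h1 : signAvg n (fun e => |∑ i, (e i).1 * v t₀ i|) ≤ r := by
    have := signAvg_norm_le (n := n) (fun i => v t₀ i) (fun _ => (0 : ℝ)) hr0
    simp only [smul_eq_mul, mul_zero, add_zero, Real.norm_eq_abs, abs_zero] at this
    refine this.trans ?_
    have h2 : ∑ i : Fin n, (|v t₀ i| ^ 2 + 0 ^ 2) ≤ r ^ 2 := by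
      calc ∑ i : Fin n, (|v t₀ i| ^ 2 + 0 ^ 2) ≤ ∑ i : Fin n, (1 : ℝ) :=
            Finset.sum_le_sum fun i _ => by
              have := pow_le_one₀ (n := 2) (abs_nonneg _) (hv t₀ i)
              linarith
        _ = r ^ 2 := by simp [hr2]
    have h3 : (∑ i : Fin n, (|v t₀ i| ^ 2 + 0 ^ 2)) / r ≤ r := by
      rw [div_le_iff₀ hr0]; nlinarith
    linarith
  -- the contraction
  let lip : Fin n → ℝ := fun i => 3 + (B * ‖x i‖) ^ 2 / a ^ 2
  -- The scale √p balances the two effects: the parameter has size O(√p), while the Lipschitz factor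
  -- `lip i` stays O(1) when ‖x i‖² is of order p.
  let β : ι → ℝ := fun t => a * Real.arctan (t.2 / a)
  have hlip : ∀ i, 0 ≤ lip i := fun i => by simp only [lip]; positivity
  have hβ : ∀ t, |β t| ≤ 2 * a := fun t => by
    simp only [β]
    rw [abs_mul, abs_of_pos ha0, mul_comm]
    refine mul_le_mul_of_nonneg_right ?_ ha0.le
    have h1 := Real.arctan_lt_pi_div_two (t.2 / a)
    have h2 := Real.neg_pi_div_two_lt_arctan (t.2 / a)
    have h3 := Real.pi_lt_four
    exact abs_le.mpr ⟨by linarith, by linarith⟩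
  have hin : ∀ (t : ι) i, |inner ℝ t.1.1 (x i)| ≤ B * ‖x i‖ := fun t i =>
    (abs_real_inner_le_norm _ _).trans (mul_le_mul_of_nonneg_right t.1.2 (norm_nonneg _))
  have h2 : signAvg n (fun e => ⨆ t, ∑ i, (e i).1 * v t i) ≤
      signAvg n (fun e => ⨆ t : ι, ∑ i, ((e i).1 * (inner ℝ t.1.1 (x i) / 2) +
        (e i).2 * (2 * lip i * β t))) := by
    have := signAvg_iSup_contraction (n := n) (A := fun _ : ι => (0 : ℝ))
      (φ := fun i t => v t i) (a := fun i t => inner ℝ t.1.1 (x i) / 2)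
      (b := fun i t => 2 * lip i * β t)
      ⟨0, by simp⟩ (fun i => ⟨1, fun t => hv t i⟩)
      (fun i => ⟨B * ‖x i‖, fun t => by
        rw [abs_div, abs_of_pos (two_pos : (0 : ℝ) < 2)]
        linarith [hin t i, abs_nonneg (inner ℝ t.1.1 (x i))]⟩)
      (fun i => ⟨2 * lip i * (2 * a), fun t => by
        rw [abs_mul, abs_of_nonneg (mul_nonneg zero_le_two (hlip i))]
        exact mul_le_mul_of_nonneg_left (hβ t) (mul_nonneg zero_le_two (hlip i))⟩)
      (fun i t t' => by
        have e1 : |v t i - v t' i| ≤ |inner ℝ t.1.1 (x i) - inner ℝ t'.1.1 (x i)| / 4 +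
            lip i * |β t - β t'| := by
          have f1 := abs_sigmoid_sub_le (inner ℝ t.1.1 (x i) + t.2) (inner ℝ t'.1.1 (x i) + t.2)
          rw [add_sub_add_right_eq_sub] at f1
          have f2 := abs_sigmoid_shift_sub_le ha1 (hin t' i) t.2 t'.2
          exact (abs_sub_le _ _ _).trans (add_le_add f1 f2)
        rw [← sub_div, abs_div, abs_of_pos (two_pos : (0 : ℝ) < 2), ← mul_sub,
          abs_mul (2 * lip i), abs_of_nonneg (mul_nonneg zero_le_two (hlip i))]
        -- The contraction asks for a maximum of increments, not a sum; doubling both terms, X/4 + Y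
        -- ≤ max(X/2, 2Y), provides it.
        rcases le_total (|inner ℝ t.1.1 (x i) - inner ℝ t'.1.1 (x i)| / 2)
          (2 * lip i * |β t - β t'|) with h | h
        · rw [max_eq_right h]; linarith
        · rw [max_eq_left h]; linarith)
    simpa only [zero_add] using this
  -- After linearization the supremum is explicit: w contributes at most B times a norm, and the
  -- shift parameter at most 2√p times a scalar sign sum.
  have h3 : signAvg n (fun e => ⨆ t : ι, ∑ i, ((e i).1 * (inner ℝ t.1.1 (x i) / 2) +
        (e i).2 * (2 * lip i * β t))) ≤
      B / 2 * signAvg n (fun e => ‖∑ i, ((e i).1 • x i +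
        (e i).2 • (0 : EuclideanSpace ℝ (Fin p)))‖) +
      4 * a * signAvg n (fun e => ‖∑ i, ((e i).1 • (0 : ℝ) + (e i).2 • lip i)‖) := by
    rw [← signAvg_const_mul, ← signAvg_const_mul, ← signAvg_add]
    refine signAvg_mono fun e => ciSup_le fun t => ?_
    simp only [smul_zero, add_zero, zero_add]
    have e1 : ∑ i, ((e i).1 * (inner ℝ t.1.1 (x i) / 2) + (e i).2 * (2 * lip i * β t)) =
        inner ℝ t.1.1 (∑ i, (e i).1 • x i) / 2 + 2 * β t * ∑ i, (e i).2 • lip i := by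
      rw [inner_sum, Finset.sum_div, Finset.mul_sum, ← Finset.sum_add_distrib]
      refine Finset.sum_congr rfl fun i _ => ?_
      rw [real_inner_smul_right, smul_eq_mul]
      ring
    rw [e1]
    refine add_le_add ?_ ?_
    · have := (real_inner_le_norm t.1.1 (∑ i, (e i).1 • x i)).trans
        (mul_le_mul_of_nonneg_right t.1.2 (norm_nonneg _))
      linarith
    · refine (le_abs_self _).trans ?_
      rw [abs_mul, abs_mul, abs_of_pos (two_pos : (0 : ℝ) < 2), Real.norm_eq_abs]
      exact mul_le_mul_of_nonneg_right (by linarith [hβ t]) (abs_nonneg _)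
  set Q := ∑ i, ‖x i‖ ^ 4 / (p : ℝ) ^ 2 with hQ
  have hQ0 : 0 ≤ Q := Finset.sum_nonneg fun i _ => by positivity
  -- The free parameter `s` is taken as √(pn) here and √n below, the typical sizes of the two sums.
  have h4 := signAvg_norm_le (n := n) x (fun _ => (0 : EuclideanSpace ℝ (Fin p))) (mul_pos ha0 hr0)
  have h5 := signAvg_norm_le (n := n) (fun _ => (0 : ℝ)) lip hr0
  have e4 : (∑ i : Fin n, (‖x i‖ ^ 2 + ‖(0 : EuclideanSpace ℝ (Fin p))‖ ^ 2)) ≤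
      a ^ 2 * (Q + n) / 2 := by
    calc (∑ i : Fin n, (‖x i‖ ^ 2 + ‖(0 : EuclideanSpace ℝ (Fin p))‖ ^ 2))
        ≤ ∑ i : Fin n, a ^ 2 * (‖x i‖ ^ 4 / (p : ℝ) ^ 2 + 1) / 2 :=
          Finset.sum_le_sum fun i _ => by
            have := sq_le_of_le_pow_four (a := ‖x i‖) (p := p) (by linarith)
            rw [norm_zero, ha2]
            refine (le_of_eq (by ring)).trans (this.trans (le_of_eq ?_))
            have : (p : ℝ) ≠ 0 := by positivity
            field_simp
      _ = a ^ 2 * (Q + n) / 2 := by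
          rw [← Finset.sum_div, ← Finset.mul_sum, Finset.sum_add_distrib]; simp [hQ]
  have e5 : (∑ i : Fin n, (‖(0 : ℝ)‖ ^ 2 + ‖lip i‖ ^ 2)) ≤ 18 * n + 2 * B ^ 4 * Q := by
    calc (∑ i : Fin n, (‖(0 : ℝ)‖ ^ 2 + ‖lip i‖ ^ 2))
        ≤ ∑ i : Fin n, (18 + 2 * B ^ 4 * (‖x i‖ ^ 4 / (p : ℝ) ^ 2)) :=
          Finset.sum_le_sum fun i _ => by
            rw [norm_zero, Real.norm_eq_abs, sq_abs]
            simp only [lip]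
            rw [ha2]
            have : (2 * B ^ 4 * (‖x i‖ ^ 4 / (p : ℝ) ^ 2)) =
                2 * ((B * ‖x i‖) ^ 2 / p) ^ 2 := by ring
            rw [this]
            nlinarith [sq_nonneg ((B * ‖x i‖) ^ 2 / p - 3)]
      _ = 18 * n + 2 * B ^ 4 * Q := by
          rw [Finset.sum_add_distrib, ← Finset.mul_sum]; simp [hQ, mul_comm]
  have f4 : (∑ i : Fin n, (‖x i‖ ^ 2 + ‖(0 : EuclideanSpace ℝ (Fin p))‖ ^ 2)) / (a * r) ≤
      a / r * ((Q + n) / 2) := by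
    rw [div_le_iff₀ (mul_pos ha0 hr0)]
    refine e4.trans (le_of_eq ?_)
    field_simp
  have f5 : (∑ i : Fin n, (‖(0 : ℝ)‖ ^ 2 + ‖lip i‖ ^ 2)) / r ≤
      (18 * n + 2 * B ^ 4 * Q) / r := by gcongr
  have g1 : a * r = a / r * n := by rw [← hr2]; field_simp
  have g2 : r = n / r := by rw [← hr2]; field_simp
  have k1 : signAvg n (fun e => |∑ i, (e i).1 * v t₀ i|) ≤ a / r * n := by
    rw [← g1]; exact h1.trans (le_mul_of_one_le_left hr0.le ha1)
  have k4 := h4.trans (show _ ≤ a / r * ((Q + 3 * n) / 4) by rw [g1] at f4 ⊢; linarith)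
  have k5 := h5.trans (show _ ≤ (19 * n + 2 * B ^ 4 * Q) / r / 2 by
    have : (19 * n + 2 * B ^ 4 * Q) / r = (18 * n + 2 * B ^ 4 * Q) / r + n / r := by ring
    rw [this, ← g2]; linarith)
  have m4 := mul_le_mul_of_nonneg_left k4 (show 0 ≤ B / 2 by positivity)
  have m5 := mul_le_mul_of_nonneg_left k5 (show 0 ≤ 4 * a by positivity)
  have g5 : 4 * a * ((19 * n + 2 * B ^ 4 * Q) / r / 2) =
      a / r * (2 * (19 * n + 2 * B ^ 4 * Q)) := by ring
  rw [g5] at m5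
  rw [hsq]
  have har : 0 ≤ a / r := by positivity
  -- The constant 77 is 1 + 2·2·19: the base term plus the shift term. The multiples of B are
  -- rounded up.
  have hfin : a / r * n + 2 * (B / 2 * (a / r * ((Q + 3 * n) / 4)) +
      a / r * (2 * (19 * n + 2 * B ^ 4 * Q))) ≤
      a / r * ((77 + B) * n + (B + 8 * B ^ 4) * Q) := by
    have : a / r * ((77 + B) * n + (B + 8 * B ^ 4) * Q) -
      (a / r * n + 2 * (B / 2 * (a / r * ((Q + 3 * n) / 4)) +
      a / r * (2 * (19 * n + 2 * B ^ 4 * Q)))) = a / r * (B * n / 4 + 3 * B * Q / 4) := by ring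
    have h0 : 0 ≤ a / r * (B * n / 4 + 3 * B * Q / 4) := by positivity
    linarith
  linarith

/-! ### The bounded difference inequality -/

theorem measurePreserving_cons {α : Type*} [MeasurableSpace α] (P : Measure α)
    [IsProbabilityMeasure P] (n : ℕ) :
    MeasurePreserving (fun z : α × (Fin n → α) => (Fin.cons z.1 z.2 : Fin (n + 1) → α))
      (P.prod (Measure.pi fun _ => P)) (Measure.pi fun _ => P) := by
  have := (measurePreserving_piFinSuccAbove (fun _ : Fin (n + 1) => P) 0).symm
  convert! this using 1
  funext z
  simp [MeasurableEquiv.piFinSuccAbove]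
  rfl

theorem integrable_of_abs_le {α : Type*} [MeasurableSpace α] {P : Measure α}
    [IsFiniteMeasure P] {g : α → ℝ} (hg : Measurable g) {M : ℝ} (hM : ∀ x, |g x| ≤ M) :
    Integrable g P :=
  Integrable.of_bound hg.aestronglyMeasurable M (Filter.Eventually.of_forall hM)

theorem abs_integral_le_of_abs_le {α : Type*} [MeasurableSpace α] {P : Measure α}
    [IsProbabilityMeasure P] {g : α → ℝ} {M : ℝ} (hM : ∀ x, |g x| ≤ M) :
    |∫ x, g x ∂P| ≤ M := by
  have h : ∀ x, ‖g x‖ ≤ M := hM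
  simpa using norm_integral_le_of_norm_le_const (μ := P) (Filter.Eventually.of_forall h)

/-- The exponential moments of a function of independent variables with bounded differences. -/
theorem integral_exp_le_of_bounded_differences {α : Type*} [MeasurableSpace α] (P : Measure α)
    [IsProbabilityMeasure P] {c M : ℝ} (n : ℕ) {g : (Fin n → α) → ℝ}
    (hg : Measurable g) (hM : ∀ x, |g x| ≤ M)
    (hd : ∀ i x y, (∀ j, j ≠ i → x j = y j) → g x - g y ≤ c) (t : ℝ) :
    ∫ x, Real.exp (t * (g x - ∫ y, g y ∂(Measure.pi fun _ => P))) ∂(Measure.pi fun _ => P) ≤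
      Real.exp (n * (c ^ 2 / 4) * t ^ 2 / 2) := by
  induction n with
  | zero =>
    have h : ∀ x : Fin 0 → α, g x = g Fin.elim0 := fun x => congrArg g (Subsingleton.elim _ _)
    simp [h]
  | succ n ih =>
    have : Nonempty α := nonempty_of_isProbabilityMeasure P
    have hmp := measurePreserving_cons P n
    -- Averaging out one variable splits g - E g into (g - h) + (h - E h). Hoeffding's lemma in that
    -- variable handles g - h for each fixed value of the others; h again has differences bounded by
    -- `c`, so induction handles the rest.
    set h : (Fin n → α) → ℝ := fun y => ∫ a, g (Fin.cons a y) ∂P with hh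
    have hgc : Measurable fun z : α × (Fin n → α) => g (Fin.cons z.1 z.2) :=
      hg.comp hmp.measurable
    have hhm : Measurable h := hgc.stronglyMeasurable.integral_prod_left.measurable
    have hhM : ∀ y, |h y| ≤ M := fun y => abs_integral_le_of_abs_le fun a => hM _
    have hgy : ∀ y, Measurable fun a => g (Fin.cons a y) := fun y =>
      hgc.comp measurable_prodMk_right
    have hint : ∀ y, Integrable (fun a => g (Fin.cons a y)) P := fun y =>
      integrable_of_abs_le (hgy y) fun a => hM _
    have hhd : ∀ i x y, (∀ j, j ≠ i → x j = y j) → h x - h y ≤ c := by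
      intro i x y hxy
      rw [hh, ← integral_sub (hint x) (hint y)]
      have : ∀ a, g (Fin.cons a x) - g (Fin.cons a y) ≤ c := fun a => hd i.succ _ _ fun j => by
        refine Fin.cases (fun _ => rfl) (fun j hj => ?_) j
        simpa using hxy j fun h => hj (by rw [h])
      calc ∫ a, (g (Fin.cons a x) - g (Fin.cons a y)) ∂P ≤ ∫ _, c ∂P :=
            integral_mono ((hint x).sub (hint y)) (integrable_const c) this
        _ = c := by simp
    have hmean : ∫ y, g y ∂(Measure.pi fun _ => P) = ∫ y, h y ∂(Measure.pi fun _ => P) := by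
      rw [← hmp.map_eq, integral_map hmp.measurable.aemeasurable hg.aestronglyMeasurable,
        integral_prod_symm _ (integrable_of_abs_le hgc fun z => hM _)]
    set m := ∫ y, h y ∂(Measure.pi fun _ => P) with hm
    have hexpb : ∀ u : ℝ, |u| ≤ 2 * M → |Real.exp (t * u)| ≤ Real.exp (|t| * (2 * M)) := by
      intro u hu
      rw [abs_of_pos (Real.exp_pos _), Real.exp_le_exp]
      refine (le_abs_self _).trans ?_
      rw [abs_mul]
      exact mul_le_mul_of_nonneg_left hu (abs_nonneg _)
    have hmM : |m| ≤ M := abs_integral_le_of_abs_le hhM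
    have hsub : ∀ u v : ℝ, |u| ≤ M → |v| ≤ M → |u - v| ≤ 2 * M := fun u v hu hv =>
      (abs_sub _ _).trans (by linarith)
    have hinner : ∀ y, ∫ a, Real.exp (t * (g (Fin.cons a y) - h y)) ∂P ≤
        Real.exp (c ^ 2 / 4 * t ^ 2 / 2) := by
      intro y
      have hbdA : BddAbove (Set.range fun a => g (Fin.cons a y)) :=
        ⟨M, by rintro _ ⟨a, rfl⟩; exact (abs_le.mp (hM _)).2⟩
      have hbdB : BddBelow (Set.range fun a => g (Fin.cons a y)) :=
        ⟨-M, by rintro _ ⟨a, rfl⟩; exact (abs_le.mp (hM _)).1⟩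
      set lo := ⨅ a, g (Fin.cons a y) with hlo
      set hi := ⨆ a, g (Fin.cons a y) with hhi
      have hr : hi - lo ≤ c := by
        have : hi ≤ lo + c := by
          refine ciSup_le fun a => ?_
          have : g (Fin.cons a y) - c ≤ lo := le_ciInf fun a' => by
            have := hd 0 (Fin.cons a y) (Fin.cons a' y) fun j => by
              refine Fin.cases (fun h => absurd rfl h) (fun j _ => by simp) j
            linarith
          linarith
        linarith
      have hr0 : 0 ≤ hi - lo := by
        obtain ⟨a⟩ := ‹Nonempty α›
        have h1 := le_ciSup hbdA a
        have h2 := ciInf_le hbdB a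
        linarith
      have := (hasSubgaussianMGF_of_mem_Icc (μ := P) (X := fun a => g (Fin.cons a y))
        (a := lo) (b := hi) (hgy y).aemeasurable
        (Filter.Eventually.of_forall fun a => ⟨ciInf_le hbdB a, le_ciSup hbdA a⟩)).mgf_le t
      refine le_trans this (Real.exp_le_exp.mpr ?_)
      have e : (((‖hi - lo‖₊ / 2) ^ 2 : NNReal) : ℝ) = (hi - lo) ^ 2 / 4 := by
        push_cast
        rw [Real.norm_eq_abs, abs_of_nonneg hr0]
        ring
      rw [e]
      have : (hi - lo) ^ 2 ≤ c ^ 2 := pow_le_pow_left₀ hr0 hr 2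
      gcongr
    rw [hmean]
    have hmeas1 : Measurable fun x : Fin (n + 1) → α => Real.exp (t * (g x - m)) := by fun_prop
    have hmeas2 : Measurable fun z : α × (Fin n → α) =>
        Real.exp (t * (g (Fin.cons z.1 z.2) - m)) := hmeas1.comp hmp.measurable
    rw [← hmp.map_eq, integral_map hmp.measurable.aemeasurable hmeas1.aestronglyMeasurable,
      integral_prod_symm _ (integrable_of_abs_le hmeas2 fun z => hexpb _ (hsub _ _ (hM _) hmM))]
    have hsplit : ∀ y : Fin n → α, ∫ a, Real.exp (t * (g (Fin.cons a y) - m)) ∂P =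
        (∫ a, Real.exp (t * (g (Fin.cons a y) - h y)) ∂P) * Real.exp (t * (h y - m)) := by
      intro y
      rw [← integral_mul_const]
      refine integral_congr_ae (Filter.Eventually.of_forall fun a => ?_)
      simp only
      rw [← Real.exp_add]
      ring_nf
    simp only [hsplit]
    have hI : Integrable (fun y : Fin n → α => Real.exp (t * (h y - m)))
        (Measure.pi fun _ => P) :=
      integrable_of_abs_le (by fun_prop) fun y => hexpb _ (hsub _ _ (hhM _) hmM)
    calc ∫ y : Fin n → α, (∫ a, Real.exp (t * (g (Fin.cons a y) - h y)) ∂P) *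
          Real.exp (t * (h y - m)) ∂(Measure.pi fun _ => P)
        ≤ ∫ y : Fin n → α, Real.exp (c ^ 2 / 4 * t ^ 2 / 2) *
          Real.exp (t * (h y - m)) ∂(Measure.pi fun _ => P) := by
          refine integral_mono_of_nonneg (Filter.Eventually.of_forall fun y => ?_)
            (hI.const_mul _) (Filter.Eventually.of_forall fun y => ?_)
          · exact mul_nonneg (integral_nonneg fun a => (Real.exp_pos _).le) (Real.exp_pos _).le
          · exact mul_le_mul_of_nonneg_right (hinner y) (Real.exp_pos _).le
      _ = Real.exp (c ^ 2 / 4 * t ^ 2 / 2) *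
          ∫ y : Fin n → α, Real.exp (t * (h y - m)) ∂(Measure.pi fun _ => P) :=
          integral_const_mul _ _
      _ ≤ Real.exp (c ^ 2 / 4 * t ^ 2 / 2) * Real.exp (n * (c ^ 2 / 4) * t ^ 2 / 2) :=
          mul_le_mul_of_nonneg_left (ih hhm hhM hhd) (Real.exp_pos _).le
      _ = Real.exp ((n + 1 : ℕ) * (c ^ 2 / 4) * t ^ 2 / 2) := by
          rw [← Real.exp_add]; push_cast; ring_nf

/-- The bounded difference inequality (McDiarmid). -/
theorem measureReal_ge_le_of_bounded_differences {α : Type*} [MeasurableSpace α] (P : Measure α)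
    [IsProbabilityMeasure P] {c M : ℝ} (n : ℕ) {g : (Fin n → α) → ℝ}
    (hg : Measurable g) (hM : ∀ x, |g x| ≤ M)
    (hd : ∀ i x y, (∀ j, j ≠ i → x j = y j) → g x - g y ≤ c) {s : ℝ} (hs : 0 ≤ s) :
    (Measure.pi fun _ => P).real {x | s ≤ g x - ∫ y, g y ∂(Measure.pi fun _ => P)} ≤
      Real.exp (-s ^ 2 / (2 * (n * (c ^ 2 / 4)))) := by
  have hsub : HasSubgaussianMGF (fun x => g x - ∫ y, g y ∂(Measure.pi fun _ => P))
      ⟨n * (c ^ 2 / 4), by positivity⟩ (Measure.pi fun _ : Fin n => P) := by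
    refine ⟨fun t => ?_, fun t => integral_exp_le_of_bounded_differences P n hg hM hd t⟩
    refine integrable_of_abs_le (M := Real.exp (|t| * (2 * M))) (by fun_prop) fun x => ?_
    rw [abs_of_pos (Real.exp_pos _), Real.exp_le_exp]
    refine (le_abs_self _).trans ?_
    rw [abs_mul]
    refine mul_le_mul_of_nonneg_left ((abs_sub _ _).trans ?_) (abs_nonneg _)
    linarith [hM x, abs_integral_le_of_abs_le (P := Measure.pi fun _ : Fin n => P) hM]
  exact hsub.measure_ge_le hs

/-! ### The deviation over a class: continuity, symmetrization, change of law -/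

theorem iSup_abs_le_add {ι : Type*} [Nonempty ι] {a b : ι → ℝ} {M r : ℝ} (hb : ∀ t, |b t| ≤ M)
    (h : ∀ t, |a t - b t| ≤ r) : ⨆ t, |a t| ≤ (⨆ t, |b t|) + r := by
  have hbdd : BddAbove (Set.range fun t => |b t|) :=
    bddAbove_range_of_abs_le (K := M) fun t => by rw [abs_abs]; exact hb t
  refine ciSup_le fun t => ?_
  have h1 := le_ciSup hbdd t
  have h2 := abs_sub_abs_le_abs_sub (a t) (b t)
  have h3 := h t
  linarith

/-- The classes are uncountable; measurability of their suprema comes from a common Lipschitz bound.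
-/
theorem continuous_iSup_abs {ι E : Type*} [Nonempty ι] [NormedAddCommGroup E] {n : ℕ}
    {v : ι → (Fin n → E) → ℝ} {M C : ℝ} (hM : ∀ t x, |v t x| ≤ M)
    (h : ∀ t x y, |v t x - v t y| ≤ C * ∑ i, ‖x i - y i‖) :
    Continuous fun x => ⨆ t, |v t x| := by
  refine continuous_iff_continuousAt.mpr fun x => ?_
  refine tendsto_iff_dist_tendsto_zero.mpr ?_
  refine squeeze_zero (g := fun y => C * ∑ i, ‖y i - x i‖) (fun y => dist_nonneg) (fun y => ?_) ?_
  · rw [Real.dist_eq, abs_le]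
    have h1 := iSup_abs_le_add (fun t => hM t x) fun t => h t y x
    have h2 := iSup_abs_le_add (fun t => hM t y) fun t => h t x y
    simp only [norm_sub_rev (x _)] at h2
    exact ⟨by linarith, by linarith⟩
  · have : Continuous fun y : Fin n → E => C * ∑ i, ‖y i - x i‖ := by fun_prop
    simpa using this.tendsto x

/-- The largest deviation over the class `F` of the empirical means from the means under `Q`. -/
noncomputable def sampleDev {α : Type*} [MeasurableSpace α] {n : ℕ} (F : Set (α → ℝ))
    (Q : Measure α) (x : Fin n → α) : ℝ :=
  ⨆ f : F, |(∑ i, f.1 (x i)) / n - ∫ y, f.1 y ∂Q|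

theorem abs_mean_le {n : ℕ} {v : Fin n → ℝ} {M : ℝ} (hM : 0 ≤ M) (h : ∀ i, |v i| ≤ M) :
    |(∑ i, v i) / n| ≤ M := by
  rw [abs_div, Nat.abs_cast]
  refine div_le_of_le_mul₀ (Nat.cast_nonneg n) hM ?_
  calc |∑ i, v i| ≤ ∑ i, |v i| := Finset.abs_sum_le_sum_abs _ _
    _ ≤ ∑ _i : Fin n, M := Finset.sum_le_sum fun i _ => h i
    _ = M * n := by simp [mul_comm]

section Deviation

variable {p n : ℕ} {K : ℝ} {F : Set (EuclideanSpace ℝ (Fin p) → ℝ)}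

theorem continuous_of_mem_boundedLip {f : EuclideanSpace ℝ (Fin p) → ℝ}
    (hf : f ∈ boundedLip p K) : Continuous f := by
  refine continuous_iff_continuousAt.mpr fun x => ?_
  refine tendsto_iff_dist_tendsto_zero.mpr ?_
  refine squeeze_zero (g := fun y => K * ‖y - x‖) (fun y => dist_nonneg) (fun y => ?_) ?_
  · rw [Real.dist_eq]; exact hf.2 y x
  · have : Continuous fun y : EuclideanSpace ℝ (Fin p) => K * ‖y - x‖ := by fun_prop
    simpa using this.tendsto x

theorem abs_dev_le_two {Q : Measure (EuclideanSpace ℝ (Fin p))} [IsProbabilityMeasure Q]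
    (hF : F ⊆ boundedLip p K) (f : F) (x : Fin n → EuclideanSpace ℝ (Fin p)) :
    |(∑ i, f.1 (x i)) / n - ∫ y, f.1 y ∂Q| ≤ 2 := by
  have h1 := abs_mean_le zero_le_one fun i => (hF f.2).1 (x i)
  have h2 := abs_integral_le_of_abs_le (P := Q) (hF f.2).1
  refine (abs_sub _ _).trans ?_
  linarith

theorem abs_dev_sub_le {c : ℝ} (hF : F ⊆ boundedLip p K) (f : F)
    (x y : Fin n → EuclideanSpace ℝ (Fin p)) :
    |((∑ i, f.1 (x i)) / n - c) - ((∑ i, f.1 (y i)) / n - c)| ≤ K / n * ∑ i, ‖x i - y i‖ := by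
  rw [sub_sub_sub_cancel_right, ← sub_div, ← Finset.sum_sub_distrib, abs_div, Nat.abs_cast,
    div_mul_eq_mul_div, Finset.mul_sum]
  gcongr
  exact (Finset.abs_sum_le_sum_abs _ _).trans (Finset.sum_le_sum fun i _ => (hF f.2).2 _ _)

variable {Q : Measure (EuclideanSpace ℝ (Fin p))} [IsProbabilityMeasure Q]

theorem continuous_sampleDev [Nonempty F] (hF : F ⊆ boundedLip p K) :
    Continuous fun x : Fin n → EuclideanSpace ℝ (Fin p) => sampleDev F Q x :=
  continuous_iSup_abs (fun f x => abs_dev_le_two hF f x) fun f x y => abs_dev_sub_le hF f x y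

theorem sampleDev_le_add [Nonempty F] (hF : F ⊆ boundedLip p K)
    (x y : Fin n → EuclideanSpace ℝ (Fin p)) :
    sampleDev F Q x ≤ sampleDev F Q y + K / n * ∑ i, ‖x i - y i‖ :=
  iSup_abs_le_add (fun f => abs_dev_le_two hF f y) fun f => abs_dev_sub_le hF f x y

theorem abs_sampleDev_le [Nonempty F] (hF : F ⊆ boundedLip p K)
    (x : Fin n → EuclideanSpace ℝ (Fin p)) : |sampleDev F Q x| ≤ 2 := by
  rw [sampleDev, abs_of_nonneg (Real.iSup_nonneg fun _ => abs_nonneg _)]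
  exact ciSup_le fun f => abs_dev_le_two hF f x

theorem sampleDev_sub_le [Nonempty F] (hF : F ⊆ boundedLip p K) (i : Fin n)
    (x y : Fin n → EuclideanSpace ℝ (Fin p)) (hxy : ∀ j, j ≠ i → x j = y j) :
    sampleDev F Q x - sampleDev F Q y ≤ 2 / n := by
  have := iSup_abs_le_add (r := 2 / n) (fun f => abs_dev_le_two (Q := Q) hF f y)
    (a := fun f : F => (∑ i, f.1 (x i)) / n - ∫ y, f.1 y ∂Q) fun f => by
      rw [sub_sub_sub_cancel_right, ← sub_div, ← Finset.sum_sub_distrib, abs_div, Nat.abs_cast,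
        Finset.sum_eq_single i (fun j _ hj => by rw [hxy j hj, sub_self]) (by simp)]
      gcongr
      refine (abs_sub _ _).trans ?_
      linarith [(hF f.2).1 (x i), (hF f.2).1 (y i)]
  simp only [sampleDev]
  linarith

theorem abs_signed_sum_sub_le (hK : 0 ≤ K) (hF : F ⊆ boundedLip p K) (f : F) (e : Fin n → ℝ)
    (x y : Fin n → EuclideanSpace ℝ (Fin p)) :
    |∑ i, e i * f.1 (x i) - ∑ i, e i * f.1 (y i)| ≤ (∑ i, |e i|) * K * ∑ i, ‖x i - y i‖ := by
  rw [← Finset.sum_sub_distrib, mul_assoc, Finset.sum_mul]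
  refine (Finset.abs_sum_le_sum_abs _ _).trans (Finset.sum_le_sum fun i _ => ?_)
  rw [← mul_sub, abs_mul]
  refine mul_le_mul_of_nonneg_left (((hF f.2).2 _ _).trans ?_) (abs_nonneg _)
  exact mul_le_mul_of_nonneg_left
    (Finset.single_le_sum (f := fun i => ‖x i - y i‖) (fun i _ => norm_nonneg _)
      (Finset.mem_univ i)) hK

theorem continuous_signed_sup [Nonempty F] (hK : 0 ≤ K) (hF : F ⊆ boundedLip p K)
    (e : Fin n → ℝ) :
    Continuous fun x : Fin n → EuclideanSpace ℝ (Fin p) => ⨆ f : F, |∑ i, e i * f.1 (x i)| :=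
  continuous_iSup_abs (fun f x => abs_sum_mul_le e _ fun i => (hF f.2).1 (x i))
    fun f x y => abs_signed_sum_sub_le hK hF f e x y

theorem abs_signed_sup_le [Nonempty F] (hF : F ⊆ boundedLip p K) (e : Fin n → ℝ)
    (x : Fin n → EuclideanSpace ℝ (Fin p)) : |(⨆ f : F, |∑ i, e i * f.1 (x i)|)| ≤ ∑ i, |e i| := by
  rw [abs_of_nonneg (Real.iSup_nonneg fun _ => abs_nonneg _)]
  exact ciSup_le fun f => abs_sum_mul_le e _ fun i => (hF f.2).1 (x i)

theorem integrable_radOn [Nonempty F] (hK : 0 ≤ K) (hF : F ⊆ boundedLip p K) :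
    Integrable (fun x : Fin n → EuclideanSpace ℝ (Fin p) => radOn F x)
      (Measure.pi fun _ => Q) :=
  (integral_signAvg fun e => integrable_of_abs_le
    (continuous_signed_sup hK hF fun i => (e i).1).measurable
    fun x => abs_signed_sup_le hF (fun i => (e i).1) x).1

theorem integral_pi_mean {f : EuclideanSpace ℝ (Fin p) → ℝ} (hf : f ∈ boundedLip p K) :
    ∫ x : Fin n → EuclideanSpace ℝ (Fin p), ∑ i, f (x i) ∂(Measure.pi fun _ => Q) =
      n * ∫ y, f y ∂Q := by
  have hfm := (continuous_of_mem_boundedLip hf).measurable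
  rw [integral_finsetSum]
  · have : ∀ i : Fin n, ∫ x : Fin n → EuclideanSpace ℝ (Fin p), f (x i)
        ∂(Measure.pi fun _ => Q) = ∫ y, f y ∂Q := fun i => by
      have hmp := measurePreserving_eval (fun _ : Fin n => Q) i
      conv_rhs => rw [← hmp.map_eq]
      rw [integral_map hmp.measurable.aemeasurable hfm.aestronglyMeasurable]
    simp [this]
  · exact fun i _ => integrable_of_abs_le (hfm.comp (measurable_pi_apply i)) fun x => hf.1 _

/-- The class of differences `f(x) - f(x')`, with signs, on a doubled sample. -/
noncomputable def symSup (F : Set (EuclideanSpace ℝ (Fin p) → ℝ)) (e : Fin n → ℝ)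
    (z : Fin n → EuclideanSpace ℝ (Fin p) × EuclideanSpace ℝ (Fin p)) : ℝ :=
  ⨆ f : F, |∑ i, e i * (f.1 (z i).1 - f.1 (z i).2)|

theorem abs_symSum_le (hF : F ⊆ boundedLip p K) (f : F) (e : Fin n → ℝ)
    (z : Fin n → EuclideanSpace ℝ (Fin p) × EuclideanSpace ℝ (Fin p)) :
    |∑ i, e i * (f.1 (z i).1 - f.1 (z i).2)| ≤ 2 * ∑ i, |e i| := by
  have h1 := abs_sum_mul_le e _ fun i => (hF f.2).1 (z i).1
  have h2 := abs_sum_mul_le e _ fun i => (hF f.2).1 (z i).2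
  simp only [mul_sub, Finset.sum_sub_distrib]
  refine (abs_sub _ _).trans ?_
  linarith

theorem measurable_symSup [Nonempty F] (hK : 0 ≤ K) (hF : F ⊆ boundedLip p K) (e : Fin n → ℝ) :
    Measurable (symSup F e) := by
  refine (continuous_iSup_abs (M := 2 * ∑ i, |e i|) (C := 2 * ((∑ i, |e i|) * K))
    (fun f z => abs_symSum_le hF f e z) fun f z z' => ?_).measurable
  have h1 := abs_signed_sum_sub_le hK hF f e (fun i => (z i).1) fun i => (z' i).1
  have h2 := abs_signed_sum_sub_le hK hF f e (fun i => (z i).2) fun i => (z' i).2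
  have h0 : 0 ≤ (∑ i, |e i|) * K := mul_nonneg (Finset.sum_nonneg fun i _ => abs_nonneg _) hK
  have h3 : ∑ i, ‖(z i).1 - (z' i).1‖ ≤ ∑ i, ‖z i - z' i‖ :=
    Finset.sum_le_sum fun i _ => norm_fst_le (z i - z' i)
  have h4 : ∑ i, ‖(z i).2 - (z' i).2‖ ≤ ∑ i, ‖z i - z' i‖ :=
    Finset.sum_le_sum fun i _ => norm_snd_le (z i - z' i)
  have h5 := mul_le_mul_of_nonneg_left h3 h0
  have h6 := mul_le_mul_of_nonneg_left h4 h0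
  simp only [mul_sub, Finset.sum_sub_distrib]
  rw [sub_sub_sub_comm]
  refine (abs_sub _ _).trans ?_
  linarith

theorem abs_symSup_le [Nonempty F] (hF : F ⊆ boundedLip p K) (e : Fin n → ℝ)
    (z : Fin n → EuclideanSpace ℝ (Fin p) × EuclideanSpace ℝ (Fin p)) :
    |symSup F e z| ≤ 2 * ∑ i, |e i| := by
  rw [symSup, abs_of_nonneg (Real.iSup_nonneg fun _ => abs_nonneg _)]
  exact ciSup_le fun f => abs_symSum_le hF f e z

/-- Symmetrization: the mean deviation is at most twice the Rademacher average. -/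
theorem integral_sampleDev_le [Nonempty F] (hK : 0 ≤ K) (hF : F ⊆ boundedLip p K) (hn : 1 ≤ n) :
    ∫ x : Fin n → EuclideanSpace ℝ (Fin p), sampleDev F Q x ∂(Measure.pi fun _ => Q) ≤
      2 * (∫ x : Fin n → EuclideanSpace ℝ (Fin p), radOn F x ∂(Measure.pi fun _ => Q)) / n := by
  have hn0 : (0 : ℝ) < n := by exact_mod_cast hn
  let one : Fin n → ℝ := fun _ => 1
  let pair : (Fin n → EuclideanSpace ℝ (Fin p)) × (Fin n → EuclideanSpace ℝ (Fin p)) →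
    Fin n → EuclideanSpace ℝ (Fin p) × EuclideanSpace ℝ (Fin p) := fun w i => (w.1 i, w.2 i)
  have hpair : MeasurePreserving pair ((Measure.pi fun _ => Q).prod (Measure.pi fun _ => Q))
      (Measure.pi fun _ => Q.prod Q) :=
    (measurePreserving_arrowProdEquivProdArrow (EuclideanSpace ℝ (Fin p))
      (EuclideanSpace ℝ (Fin p)) (Fin n) (fun _ => Q) fun _ => Q).symm
  have hmeas : ∀ e, Measurable (symSup F e) := fun e => measurable_symSup (n := n) hK hF e
  have hmeas2 : Measurable fun w => symSup F one (pair w) := (hmeas one).comp hpair.measurable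
  have hint : ∀ e : Fin n → ℝ, Integrable (symSup F e) (Measure.pi fun _ => Q.prod Q) := fun e =>
    integrable_of_abs_le (hmeas e) fun z => abs_symSup_le hF e z
  have hint2 : Integrable (fun w => symSup F one (pair w))
      ((Measure.pi fun _ => Q).prod (Measure.pi fun _ => Q)) :=
    integrable_of_abs_le hmeas2 fun z => abs_symSup_le hF one _
  -- the mean is replaced by an independent sample
  have step1 : ∀ x : Fin n → EuclideanSpace ℝ (Fin p), sampleDev F Q x ≤
      (∫ y : Fin n → EuclideanSpace ℝ (Fin p), symSup F one (pair (x, y))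
        ∂(Measure.pi fun _ => Q)) / n := by
    intro x
    refine ciSup_le fun f => ?_
    have hi : Integrable (fun y : Fin n → EuclideanSpace ℝ (Fin p) => ∑ i, f.1 (y i))
        (Measure.pi fun _ => Q) := by
      refine integrable_finsetSum _ fun i _ => ?_
      exact integrable_of_abs_le ((continuous_of_mem_boundedLip (hF f.2)).measurable.comp
        (measurable_pi_apply i)) fun x => (hF f.2).1 _
    have e1 : (∑ i, f.1 (x i)) / n - ∫ y, f.1 y ∂Q =
        (∫ y : Fin n → EuclideanSpace ℝ (Fin p), (∑ i, f.1 (x i) - ∑ i, f.1 (y i))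
          ∂(Measure.pi fun _ => Q)) / n := by
      rw [integral_sub (integrable_const _) hi, integral_pi_mean (hF f.2)]
      simp only [integral_const, probReal_univ, one_smul]
      field_simp
    rw [e1, abs_div, Nat.abs_cast]
    refine div_le_div_of_nonneg_right ((abs_integral_le_integral_abs).trans ?_) hn0.le
    refine integral_mono ((integrable_const _).sub hi).abs
      (integrable_of_abs_le (hmeas2.comp measurable_prodMk_left) fun y => abs_symSup_le hF one _)
      fun y => ?_
    have hb : BddAbove (Set.range fun f : F =>
        |∑ i, one i * (f.1 (pair (x, y) i).1 - f.1 (pair (x, y) i).2)|) :=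
      bddAbove_range_of_abs_le fun f => by rw [abs_abs]; exact abs_symSum_le hF f one _
    refine le_trans (le_of_eq ?_) (le_ciSup hb f)
    simp [one, pair]
  -- signs may be inserted
  have step2 : ∀ e : Fin n → ℝ × ℝ, (∀ i, (e i).1 = 1 ∨ (e i).1 = -1) →
      ∫ z, symSup F one z ∂(Measure.pi fun _ => Q.prod Q) ≤
        ∫ z, symSup F (fun i => (e i).1) z ∂(Measure.pi fun _ => Q.prod Q) := by
    intro e he
    -- A sign -1 amounts to exchanging the two members of the pair, which preserves the product law.
    -- Thus every sign pattern gives the same integral.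
    let T : (i : Fin n) → EuclideanSpace ℝ (Fin p) × EuclideanSpace ℝ (Fin p) →
      EuclideanSpace ℝ (Fin p) × EuclideanSpace ℝ (Fin p) := fun i =>
        if (e i).1 = 1 then id else Prod.swap
    have hT : MeasurePreserving (fun (z : Fin n → _) i => T i (z i))
        (Measure.pi fun _ => Q.prod Q) (Measure.pi fun _ => Q.prod Q) := by
      refine measurePreserving_pi _ _ fun i => ?_
      by_cases h : (e i).1 = 1
      · simp only [T, h, if_true]; exact MeasurePreserving.id _
      · simp only [T, h, if_false]; exact Measure.measurePreserving_swap
    conv_lhs => rw [← hT.map_eq]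
    rw [integral_map hT.measurable.aemeasurable (hmeas one).aestronglyMeasurable]
    refine le_of_eq (integral_congr_ae (Filter.Eventually.of_forall fun z => ?_))
    simp only [symSup]
    refine iSup_congr fun f => ?_
    congr 1
    refine Finset.sum_congr rfl fun i _ => ?_
    by_cases h : (e i).1 = 1
    · simp [T, h, one]
    · have hne : ¬(-1 : ℝ) = 1 := by norm_num
      simp [T, one, (he i).resolve_left h, hne]
  -- The triangle inequality separates the two samples; each has law Q^n, whence the factor two.
  have step3 : ∀ z, signAvg n (fun e => symSup F (fun i => (e i).1) z) ≤
      radOn F (fun i => (z i).1) + radOn F (fun i => (z i).2) := by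
    intro z
    simp only [radOn, rad]
    rw [← signAvg_add]
    refine signAvg_mono fun e => ciSup_le fun f => ?_
    have h1 := le_ciSup (bddAbove_abs_sum (v := fun (f : F) i => f.1 (z i).1)
      (fun f i => (hF f.2).1 _) fun i => (e i).1) f
    have h2 := le_ciSup (bddAbove_abs_sum (v := fun (f : F) i => f.1 (z i).2)
      (fun f i => (hF f.2).1 _) fun i => (e i).1) f
    simp only [mul_sub, Finset.sum_sub_distrib]
    exact (abs_sub _ _).trans (add_le_add h1 h2)
  have hrad := integrable_radOn (n := n) (Q := Q) hK hF
  have hradm : AEStronglyMeasurable (fun x : Fin n → EuclideanSpace ℝ (Fin p) => radOn F x)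
    (Measure.pi fun _ => Q) := hrad.1
  have hfst : MeasurePreserving (fun (z : Fin n → EuclideanSpace ℝ (Fin p) ×
      EuclideanSpace ℝ (Fin p)) i => (z i).1) (Measure.pi fun _ => Q.prod Q)
      (Measure.pi fun _ => Q) := measurePreserving_pi _ _ fun i => measurePreserving_fst
  have hsnd : MeasurePreserving (fun (z : Fin n → EuclideanSpace ℝ (Fin p) ×
      EuclideanSpace ℝ (Fin p)) i => (z i).2) (Measure.pi fun _ => Q.prod Q)
      (Measure.pi fun _ => Q) := measurePreserving_pi _ _ fun i => measurePreserving_snd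
  have e1 : ∫ z : Fin n → EuclideanSpace ℝ (Fin p) × EuclideanSpace ℝ (Fin p),
      radOn F (fun i => (z i).1) ∂(Measure.pi fun _ => Q.prod Q) =
      ∫ x : Fin n → EuclideanSpace ℝ (Fin p), radOn F x ∂(Measure.pi fun _ => Q) := by
    conv_rhs => rw [← hfst.map_eq]
    rw [integral_map hfst.measurable.aemeasurable (by rw [hfst.map_eq]; exact hradm)]
  have e2 : ∫ z : Fin n → EuclideanSpace ℝ (Fin p) × EuclideanSpace ℝ (Fin p),
      radOn F (fun i => (z i).2) ∂(Measure.pi fun _ => Q.prod Q) =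
      ∫ x : Fin n → EuclideanSpace ℝ (Fin p), radOn F x ∂(Measure.pi fun _ => Q) := by
    conv_rhs => rw [← hsnd.map_eq]
    rw [integral_map hsnd.measurable.aemeasurable (by rw [hsnd.map_eq]; exact hradm)]
  have i1 : Integrable (fun z : Fin n → EuclideanSpace ℝ (Fin p) × EuclideanSpace ℝ (Fin p) =>
      radOn F fun i => (z i).1) (Measure.pi fun _ => Q.prod Q) :=
    hfst.integrable_comp_of_integrable hrad
  have i2 : Integrable (fun z : Fin n → EuclideanSpace ℝ (Fin p) × EuclideanSpace ℝ (Fin p) =>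
      radOn F fun i => (z i).2) (Measure.pi fun _ => Q.prod Q) :=
    hsnd.integrable_comp_of_integrable hrad
  have hsym := integral_signAvg (μ := Measure.pi fun _ : Fin n => Q.prod Q)
    (F := fun e z => symSup F (fun i => (e i).1) z) fun e => hint _
  calc ∫ x : Fin n → EuclideanSpace ℝ (Fin p), sampleDev F Q x ∂(Measure.pi fun _ => Q)
      ≤ ∫ x : Fin n → EuclideanSpace ℝ (Fin p), (∫ y : Fin n → EuclideanSpace ℝ (Fin p),
          symSup F one (pair (x, y)) ∂(Measure.pi fun _ => Q)) / n ∂(Measure.pi fun _ => Q) :=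
        integral_mono (integrable_of_abs_le (continuous_sampleDev hF).measurable fun x =>
          abs_sampleDev_le hF x) (hint2.integral_prod_left.div_const _) step1
    _ = (∫ z, symSup F one z ∂(Measure.pi fun _ => Q.prod Q)) / n := by
        rw [integral_div, ← hpair.map_eq, integral_map hpair.measurable.aemeasurable
          (hmeas one).aestronglyMeasurable, integral_prod _ hint2]
    _ ≤ (∫ z, (radOn F (fun i => (z i).1) + radOn F (fun i => (z i).2))
          ∂(Measure.pi fun _ : Fin n => Q.prod Q)) / n := by
        refine div_le_div_of_nonneg_right ((le_signAvg step2).trans ?_) hn0.le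
        rw [← hsym.2]
        exact integral_mono hsym.1 (i1.add i2) step3
    _ = _ := by
        rw [integral_add i1 i2, e1, e2, two_mul]

/-- The mean deviation is stable under a change of the sampling distribution that is small in
the Wasserstein distance. -/
theorem integral_sampleDev_le_of_W1 [Nonempty F] (hK : 0 ≤ K) (hF : F ⊆ boundedLip p K)
    (hn : 1 ≤ n) (P : Measure (EuclideanSpace ℝ (Fin p))) [IsProbabilityMeasure P] {ε δ : ℝ}
    (hε : 0 ≤ ε) (hδ : 0 < δ) (hW : W1 P Q ≤ ENNReal.ofReal ε) :
    ∫ x : Fin n → EuclideanSpace ℝ (Fin p), sampleDev F Q x ∂(Measure.pi fun _ => P) ≤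
      ∫ x : Fin n → EuclideanSpace ℝ (Fin p), sampleDev F Q x ∂(Measure.pi fun _ => Q) +
        K * (ε + δ) := by
  -- The slack `δ` gives a nearly optimal coupling, so the infimum need not be attained.
  have hlt : W1 P Q < ENNReal.ofReal (ε + δ) :=
    hW.trans_lt ((ENNReal.ofReal_lt_ofReal_iff (by linarith)).mpr (by linarith))
  simp only [W1, iInf_lt_iff] at hlt
  obtain ⟨π, ⟨h1, h2⟩, hπ⟩ := hlt
  have hprob : IsProbabilityMeasure π := by
    constructor
    have : π.map Prod.fst Set.univ = 1 := by rw [h1]; exact measure_univ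
    rwa [Measure.map_apply measurable_fst MeasurableSet.univ, Set.preimage_univ] at this
  have hn0 : (0 : ℝ) < n := by exact_mod_cast hn
  -- Independent copies of the coupling have marginals P^n and Q^n, and the deviation is
  -- K/n-Lipschitz in the sum of the displacements.
  have hfst : MeasurePreserving (fun (z : Fin n → EuclideanSpace ℝ (Fin p) ×
      EuclideanSpace ℝ (Fin p)) i => (z i).1) (Measure.pi fun _ => π)
      (Measure.pi fun _ => P) := measurePreserving_pi _ _ fun i => ⟨measurable_fst, h1⟩
  have hsnd : MeasurePreserving (fun (z : Fin n → EuclideanSpace ℝ (Fin p) ×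
      EuclideanSpace ℝ (Fin p)) i => (z i).2) (Measure.pi fun _ => π)
      (Measure.pi fun _ => Q) := measurePreserving_pi _ _ fun i => ⟨measurable_snd, h2⟩
  have hm := (continuous_sampleDev (n := n) (Q := Q) hF).measurable
  have hnorm : Integrable (fun z : EuclideanSpace ℝ (Fin p) × EuclideanSpace ℝ (Fin p) =>
      z.1 - z.2) π := ⟨by fun_prop, hπ.trans ENNReal.ofReal_lt_top⟩
  have hcost : ∫ z, ‖z.1 - z.2‖ ∂π ≤ ε + δ := by
    rw [integral_norm_eq_lintegral_enorm hnorm.1]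
    exact ENNReal.toReal_le_of_le_ofReal (by linarith) hπ.le
  have hni : ∀ i : Fin n, Integrable (fun z : Fin n → EuclideanSpace ℝ (Fin p) ×
      EuclideanSpace ℝ (Fin p) => ‖(z i).1 - (z i).2‖) (Measure.pi fun _ => π) := fun i =>
    (measurePreserving_eval (fun _ : Fin n => π) i).integrable_comp_of_integrable hnorm.norm
  have hni2 : ∀ i : Fin n, ∫ z : Fin n → EuclideanSpace ℝ (Fin p) × EuclideanSpace ℝ (Fin p),
      ‖(z i).1 - (z i).2‖ ∂(Measure.pi fun _ => π) = ∫ z, ‖z.1 - z.2‖ ∂π := fun i => by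
    have hmp := measurePreserving_eval (fun _ : Fin n => π) i
    conv_rhs => rw [← hmp.map_eq]
    rw [integral_map hmp.measurable.aemeasurable (by fun_prop)]
  have hsum : Integrable (fun z : Fin n → EuclideanSpace ℝ (Fin p) × EuclideanSpace ℝ (Fin p) =>
      K / n * ∑ i, ‖(z i).1 - (z i).2‖) (Measure.pi fun _ => π) :=
    (integrable_finsetSum _ fun i _ => hni i).const_mul _
  have hi2 : Integrable (fun z : Fin n → EuclideanSpace ℝ (Fin p) × EuclideanSpace ℝ (Fin p) =>
      sampleDev F Q fun i => (z i).2) (Measure.pi fun _ => π) :=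
    integrable_of_abs_le (hm.comp hsnd.measurable) fun z => abs_sampleDev_le hF _
  rw [← hfst.map_eq, integral_map hfst.measurable.aemeasurable hm.aestronglyMeasurable,
    ← hsnd.map_eq, integral_map hsnd.measurable.aemeasurable hm.aestronglyMeasurable]
  calc _ ≤ ∫ z : Fin n → EuclideanSpace ℝ (Fin p) × EuclideanSpace ℝ (Fin p),
        ((sampleDev F Q fun i => (z i).2) + K / n * ∑ i, ‖(z i).1 - (z i).2‖)
          ∂(Measure.pi fun _ => π) :=
        integral_mono (integrable_of_abs_le (hm.comp hfst.measurable) fun z =>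
          abs_sampleDev_le hF _) (hi2.add hsum) fun z => sampleDev_le_add hF _ _
    _ = ∫ z : Fin n → EuclideanSpace ℝ (Fin p) × EuclideanSpace ℝ (Fin p),
        (sampleDev F Q fun i => (z i).2) ∂(Measure.pi fun _ => π) +
          K * ∫ z, ‖z.1 - z.2‖ ∂π := by
        rw [integral_add hi2 hsum, integral_const_mul, integral_finsetSum _ fun i _ => hni i]
        simp only [hni2]
        simp
        field_simp
    _ ≤ _ := by
        have := mul_le_mul_of_nonneg_left hcost hK
        linarith

end Deviation

/-! ### One-dimensional projections of the Gaussian -/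

section CovSpace

variable {p : ℕ} {M₁ M₂ : ℝ} {S : Matrix (Fin p) (Fin p) ℝ}

open scoped MatrixOrder in
theorem covSpace_quadratic_bounds (hS : S ∈ covSpace p M₁ M₂) (w : EuclideanSpace ℝ (Fin p)) :
    M₁ * ‖w‖ ^ 2 ≤ w.ofLp ⬝ᵥ S.mulVec w.ofLp ∧ w.ofLp ⬝ᵥ S.mulVec w.ofLp ≤ M₂ * ‖w‖ ^ 2 := by
  have hsa : IsSelfAdjoint S := hS.1.isHermitian
  have h1 : algebraMap ℝ (Matrix (Fin p) (Fin p) ℝ) M₁ ≤ S :=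
    (algebraMap_le_iff_le_spectrum hsa).mpr fun t ht => (hS.2 t ht).1
  have h2 : S ≤ algebraMap ℝ (Matrix (Fin p) (Fin p) ℝ) M₂ :=
    (le_algebraMap_iff_spectrum_le hsa).mpr fun t ht => (hS.2 t ht).2
  have e : ‖w‖ ^ 2 = w.ofLp ⬝ᵥ w.ofLp := by
    rw [EuclideanSpace.real_norm_sq_eq]; simp [dotProduct, sq]
  have k1 := (Matrix.le_iff.mp h1).dotProduct_mulVec_nonneg w.ofLp
  have k2 := (Matrix.le_iff.mp h2).dotProduct_mulVec_nonneg w.ofLp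
  simp only [star_trivial, Matrix.sub_mulVec, dotProduct_sub, Algebra.algebraMap_eq_smul_one,
    Matrix.smul_mulVec, Matrix.one_mulVec, dotProduct_smul, smul_eq_mul] at k1 k2
  rw [e]
  exact ⟨by linarith, by linarith⟩

theorem map_inner_multivariateGaussian (hS : S.PosSemidef) (w : EuclideanSpace ℝ (Fin p)) :
    (multivariateGaussian 0 S).map (fun x => inner ℝ w x) =
      gaussianReal 0 (w.ofLp ⬝ᵥ S.mulVec w.ofLp).toNNReal := by
  have h := IsGaussian.map_eq_gaussianReal (μ := multivariateGaussian 0 S) (innerSL ℝ w)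
  have hv := covarianceBilin_self (μ := multivariateGaussian 0 S) IsGaussian.memLp_two_id w
  rw [covarianceBilin_multivariateGaussian hS] at hv
  have h0 : ∫ x, innerSL ℝ w x ∂(multivariateGaussian 0 S) = 0 := by
    have := (innerSL ℝ w).integral_comp_comm (φ := id) (μ := multivariateGaussian 0 S)
      IsGaussian.integrable_id
    simpa using this
  rw [h0] at h
  have e : (⇑(innerSL ℝ w) : EuclideanSpace ℝ (Fin p) → ℝ) = fun x => inner ℝ w x := rfl
  rw [e] at h
  rw [h, hv]

end CovSpace

theorem gaussianReal_eq_map_sqrt {s : ℝ} (hs : 0 ≤ s) :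
    gaussianReal 0 s.toNNReal = (gaussianReal 0 1).map (fun z => √s * z) := by
  rw [gaussianReal_map_const_mul, mul_zero, mul_one]
  congr 1
  ext
  simp [Real.sq_sqrt hs, hs]

/-! ### Sigmoid means separate variances -/

/-- The mean of the shifted sigmoid under the centered normal distribution of variance `s`. -/
noncomputable def sigmoidMean (b s : ℝ) : ℝ := ∫ z, Real.sigmoid (√s * z + b) ∂(gaussianReal 0 1)

theorem integral_sigmoid_multivariateGaussian {p : ℕ} {S : Matrix (Fin p) (Fin p) ℝ}
    (hS : S.PosSemidef) (w : EuclideanSpace ℝ (Fin p)) (b : ℝ) :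
    ∫ x, Real.sigmoid (inner ℝ w x + b) ∂(multivariateGaussian 0 S) =
      sigmoidMean b (w.ofLp ⬝ᵥ S.mulVec w.ofLp) := by
  have hs : 0 ≤ w.ofLp ⬝ᵥ S.mulVec w.ofLp := by simpa using hS.dotProduct_mulVec_nonneg w.ofLp
  have hm : Measurable fun y : ℝ => Real.sigmoid (y + b) :=
    (continuous_sigmoid.comp (continuous_add_const b)).measurable
  have h1 := integral_map (μ := multivariateGaussian 0 S) (φ := fun x => inner ℝ w x)
    (by fun_prop) hm.aestronglyMeasurable
  rw [map_inner_multivariateGaussian hS, gaussianReal_eq_map_sqrt hs,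
    integral_map (by fun_prop) hm.aestronglyMeasurable] at h1
  exact h1.symm

theorem integral_sigmoid_comp_affine_neg (r b : ℝ) :
    ∫ z, Real.sigmoid (-(r * z) + b) ∂(gaussianReal 0 1) =
      ∫ z, Real.sigmoid (r * z + b) ∂(gaussianReal 0 1) := by
  have hm : Measurable fun z : ℝ => Real.sigmoid (r * z + b) :=
    (continuous_sigmoid.comp (by fun_prop)).measurable
  have h := integral_map (μ := gaussianReal 0 1) (φ := fun z : ℝ => -z)
    (by fun_prop) hm.aestronglyMeasurable
  rw [gaussianReal_map_neg, neg_zero] at h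
  rw [h]
  simp

theorem integrable_sigmoid_comp {f : ℝ → ℝ} (hf : Continuous f) :
    Integrable (fun z => Real.sigmoid (f z)) (gaussianReal 0 1) :=
  integrable_of_abs_le (M := 1) (continuous_sigmoid.comp hf).measurable fun z => by
    rw [abs_of_nonneg (Real.sigmoid_nonneg _)]; exact Real.sigmoid_le_one _

/-- By σ(-u) = 1 - σ(u) and the symmetry of the normal law. Changing the sign of the shift thus
reverses the inequality obtained from a one-sided objective. -/
theorem sigmoidMean_neg_one (s : ℝ) : sigmoidMean (-1) s = 1 - sigmoidMean 1 s := by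
  rw [sigmoidMean, sigmoidMean, ← integral_sigmoid_comp_affine_neg (√s) 1]
  have h1 : ∫ z, (1 - Real.sigmoid (-(√s * z) + 1)) ∂(gaussianReal 0 1) =
      1 - ∫ z, Real.sigmoid (-(√s * z) + 1) ∂(gaussianReal 0 1) := by
    rw [integral_sub (integrable_const _) (integrable_sigmoid_comp (by fun_prop))]
    simp
  rw [← h1]
  refine integral_congr_ae (Filter.Eventually.of_forall fun z => ?_)
  simp only
  rw [← Real.sigmoid_neg]
  congr 1
  ring

/-- Pairing z with -z leaves a function of cosh u, decreasing in |u|. The nonzero shift is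
essential: with shift zero the sum is constantly 1 and carries no information on the variance. -/
theorem sigmoid_add_sigmoid (u : ℝ) :
    Real.sigmoid (u + 1) + Real.sigmoid (-u + 1) =
      1 + (1 - Real.exp (-1) ^ 2) /
        (1 + Real.exp (-1) ^ 2 + 2 * Real.exp (-1) * Real.cosh u) := by
  rw [Real.sigmoid_def, Real.sigmoid_def, Real.cosh_eq, neg_add, neg_add, neg_neg, Real.exp_add,
    Real.exp_add]
  have hq := Real.exp_pos u
  have hq' := Real.exp_pos (-u)
  have ha := Real.exp_pos (-1)
  have h : Real.exp (-u) * Real.exp u = 1 := by rw [← Real.exp_add]; simp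
  set a := Real.exp (-1)
  set q := Real.exp u
  set q' := Real.exp (-u)
  have hD : 1 + a ^ 2 + 2 * a * ((q + q') / 2) = (1 + q' * a) * (1 + q * a) := by
    linear_combination (-a ^ 2) * h
  rw [hD]
  field_simp
  linear_combination (-a ^ 2) * h

/-- From cosh y - cosh x = 2 sinh((y + x)/2) sinh((y - x)/2) and sinh r ≥ r for r ≥ 0. -/
theorem cosh_sub_cosh_ge {u v : ℝ} (huv : |u| ≤ |v|) :
    (v ^ 2 - u ^ 2) / 2 ≤ Real.cosh v - Real.cosh u := by
  rw [← Real.cosh_abs u, ← Real.cosh_abs v, ← sq_abs u, ← sq_abs v]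
  have hu := abs_nonneg u
  set x := |u|
  set y := |v|
  have e1 : Real.cosh y = Real.cosh ((y + x) / 2 + (y - x) / 2) := by congr 1; ring
  have e2 : Real.cosh x = Real.cosh ((y + x) / 2 - (y - x) / 2) := by congr 1; ring
  rw [e1, e2, Real.cosh_add, Real.cosh_sub]
  have h1 : (y + x) / 2 ≤ Real.sinh ((y + x) / 2) := Real.self_le_sinh_iff.mpr (by linarith)
  have h2 : (y - x) / 2 ≤ Real.sinh ((y - x) / 2) := Real.self_le_sinh_iff.mpr (by linarith)
  have := mul_le_mul h1 h2 (by linarith) (by linarith)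
  linarith

/-- The pointwise lower bound for the decrease of the mean of the shifted sigmoid. -/
noncomputable def sigmoidGap (H z : ℝ) : ℝ :=
  (1 - Real.exp (-1) ^ 2) * Real.exp (-1) * z ^ 2 /
    (1 + Real.exp (-1) ^ 2 + 2 * Real.exp (-1) * Real.cosh (√H * z)) ^ 2

theorem exp_neg_one_lt_one : Real.exp (-1) < 1 := by
  rw [Real.exp_lt_one_iff]; norm_num

/-- A difference of reciprocals: the numerator grows at least like (t - s)z², and both denominators
are at most the one at the largest variance `H`, which makes the bound uniform in s and t. -/
theorem sigmoidGap_mul_le {H s t : ℝ} (hs : 0 ≤ s) (hst : s ≤ t) (htH : t ≤ H) (z : ℝ) :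
    sigmoidGap H z * (t - s) ≤
      (Real.sigmoid (√s * z + 1) + Real.sigmoid (-(√s * z) + 1)) -
        (Real.sigmoid (√t * z + 1) + Real.sigmoid (-(√t * z) + 1)) := by
  rw [sigmoid_add_sigmoid, sigmoid_add_sigmoid, sigmoidGap]
  have ha := Real.exp_pos (-1)
  have ha1 := exp_neg_one_lt_one
  set a := Real.exp (-1)
  have hle : ∀ x y : ℝ, x ≤ y → |√x * z| ≤ |√y * z| := fun x y hxy => by
    rw [abs_mul, abs_mul, abs_of_nonneg (Real.sqrt_nonneg _), abs_of_nonneg (Real.sqrt_nonneg _)]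
    exact mul_le_mul_of_nonneg_right (Real.sqrt_le_sqrt hxy) (abs_nonneg _)
  have hc1 := Real.cosh_le_cosh.mpr (hle s t hst)
  have hc2 := Real.cosh_le_cosh.mpr (hle t H htH)
  have hg := cosh_sub_cosh_ge (hle s t hst)
  rw [mul_pow, mul_pow, Real.sq_sqrt hs, Real.sq_sqrt (hs.trans hst)] at hg
  have hp := Real.cosh_pos (√s * z)
  set c1 := Real.cosh (√s * z)
  set c2 := Real.cosh (√t * z)
  set c3 := Real.cosh (√H * z)
  have hb : 0 < 1 - a ^ 2 := by nlinarith
  have hD1 : 0 < 1 + a ^ 2 + 2 * a * c1 := by positivity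
  have hD12 : 1 + a ^ 2 + 2 * a * c1 ≤ 1 + a ^ 2 + 2 * a * c2 := by gcongr
  have hD23 : 1 + a ^ 2 + 2 * a * c2 ≤ 1 + a ^ 2 + 2 * a * c3 := by gcongr
  have hnum : 2 * a * (c2 - c1) =
    (1 + a ^ 2 + 2 * a * c2) - (1 + a ^ 2 + 2 * a * c1) := by ring
  set D1 := 1 + a ^ 2 + 2 * a * c1
  set D2 := 1 + a ^ 2 + 2 * a * c2
  set D3 := 1 + a ^ 2 + 2 * a * c3
  have hD2 : 0 < D2 := hD1.trans_le hD12
  have hD3 : 0 < D3 := hD2.trans_le hD23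
  have e : 1 + (1 - a ^ 2) / D1 - (1 + (1 - a ^ 2) / D2) =
      (1 - a ^ 2) * (2 * a * (c2 - c1)) / (D1 * D2) := by
    rw [hnum]; field_simp; ring
  rw [e, div_mul_eq_mul_div]
  have hz : 0 ≤ (t - s) * z ^ 2 := mul_nonneg (by linarith) (sq_nonneg z)
  refine div_le_div₀ ?_ ?_ (by positivity) ?_
  · exact mul_nonneg hb.le (mul_nonneg (by positivity) (by nlinarith))
  · have : (1 - a ^ 2) * a * z ^ 2 * (t - s) =
        (1 - a ^ 2) * (2 * a * ((t * z ^ 2 - s * z ^ 2) / 2)) := by ring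
    rw [this]
    have e2 : √t ^ 2 = t := Real.sq_sqrt (hs.trans hst)
    gcongr
  · rw [sq]
    exact mul_le_mul (hD12.trans hD23) hD23 hD2.le hD3.le

theorem sigmoidGap_nonneg (H z : ℝ) : 0 ≤ sigmoidGap H z := by
  have ha := Real.exp_pos (-1)
  have ha1 := exp_neg_one_lt_one
  have hb : 0 < 1 - Real.exp (-1) ^ 2 := by nlinarith
  unfold sigmoidGap
  positivity

theorem integrable_pow_gaussianReal (k : ℕ) :
    Integrable (fun z : ℝ => z ^ k) (gaussianReal 0 1) := by
  have := (memLp_id_gaussianReal (μ := 0) (v := 1) k).integrable_norm_pow'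
  refine this.mono' (by fun_prop) (Filter.Eventually.of_forall fun z => ?_)
  simp

theorem integrable_sigmoidGap (H : ℝ) : Integrable (sigmoidGap H) (gaussianReal 0 1) := by
  have ha := Real.exp_pos (-1)
  have ha1 := exp_neg_one_lt_one
  refine (integrable_pow_gaussianReal 2).mono' ?_ (Filter.Eventually.of_forall fun z => ?_)
  · have hc := Real.continuous_cosh.measurable
    unfold sigmoidGap
    refine Measurable.aestronglyMeasurable ?_
    fun_prop
  · rw [Real.norm_eq_abs, abs_of_nonneg (sigmoidGap_nonneg H z), sigmoidGap]
    have hp := Real.cosh_pos (√H * z)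
    set a := Real.exp (-1)
    have hD : 1 ≤ 1 + a ^ 2 + 2 * a * Real.cosh (√H * z) := by
      have : 0 ≤ a ^ 2 + 2 * a * Real.cosh (√H * z) := by positivity
      linarith
    refine div_le_of_le_mul₀ (by positivity) (sq_nonneg z) ?_
    have h1 : (1 - a ^ 2) * a ≤ 1 := by nlinarith [sq_nonneg a]
    calc (1 - a ^ 2) * a * z ^ 2 ≤ 1 * z ^ 2 := mul_le_mul_of_nonneg_right h1 (sq_nonneg z)
      _ = z ^ 2 * 1 := by ring
      _ ≤ _ := mul_le_mul_of_nonneg_left (one_le_pow₀ hD) (sq_nonneg z)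

/-- The integrand vanishes only at 0, a null set of the normal law. This makes the separation
constant positive. -/
theorem integral_sigmoidGap_pos (H : ℝ) : 0 < ∫ z, sigmoidGap H z ∂(gaussianReal 0 1) := by
  rw [integral_pos_iff_support_of_nonneg (sigmoidGap_nonneg H) (integrable_sigmoidGap H)]
  have hsub : ({0} : Set ℝ)ᶜ ⊆ Function.support (sigmoidGap H) := by
    intro z hz
    have ha := Real.exp_pos (-1)
    have ha1 := exp_neg_one_lt_one
    have hb : 0 < 1 - Real.exp (-1) ^ 2 := by nlinarith
    have hp := Real.cosh_pos (√H * z)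
    have hz2 : 0 < z ^ 2 := by have : z ≠ 0 := hz; positivity
    refine ne_of_gt ?_
    unfold sigmoidGap
    positivity
  refine lt_of_lt_of_le ?_ (measure_mono hsub)
  have := nullSingletonClass_gaussianReal (μ := 0) (v := 1) one_ne_zero
  rw [prob_compl_eq_one_sub (measurableSet_singleton 0), measure_singleton]
  simp

/-- The mean of the shifted sigmoid separates the variances in a bounded range. -/
theorem sigmoidMean_separation {H s t : ℝ} (hs : 0 ≤ s) (hst : s ≤ t) (htH : t ≤ H) :
    (∫ z, sigmoidGap H z ∂(gaussianReal 0 1)) / 2 * (t - s) ≤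
      sigmoidMean 1 s - sigmoidMean 1 t := by
  have hi : ∀ r : ℝ, Integrable (fun z => Real.sigmoid (√r * z + 1)) (gaussianReal 0 1) :=
    fun r => integrable_sigmoid_comp (by fun_prop)
  have hi' : ∀ r : ℝ, Integrable (fun z => Real.sigmoid (-(√r * z) + 1)) (gaussianReal 0 1) :=
    fun r => integrable_sigmoid_comp (by fun_prop)
  have hsum : ∀ r : ℝ, ∫ z, (Real.sigmoid (√r * z + 1) + Real.sigmoid (-(√r * z) + 1))
      ∂(gaussianReal 0 1) = 2 * sigmoidMean 1 r := fun r => by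
    rw [integral_add (hi r) (hi' r), integral_sigmoid_comp_affine_neg, sigmoidMean, two_mul]
  have h := integral_mono ((integrable_sigmoidGap H).mul_const (t - s))
    (((hi s).add (hi' s)).sub ((hi t).add (hi' t))) fun z => sigmoidGap_mul_le hs hst htH z
  have e : ∫ z, ((Real.sigmoid (√s * z + 1) + Real.sigmoid (-(√s * z) + 1)) -
      (Real.sigmoid (√t * z + 1) + Real.sigmoid (-(√t * z) + 1))) ∂(gaussianReal 0 1) =
      2 * sigmoidMean 1 s - 2 * sigmoidMean 1 t := by
    rw [← hsum s, ← hsum t]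
    exact integral_sub ((hi s).add (hi' s)) ((hi t).add (hi' t))
  rw [integral_mul_const] at h
  have h2 := h.trans (le_of_eq e)
  linarith

/-! ### Gaussian fourth moments and the expected Rademacher average -/

/-- By Cauchy–Schwarz ‖y‖⁴ ≤ p ∑ yᵢ⁴, and each coordinate is centered normal with variance Sᵢᵢ ≤ M₂.
Division by p² makes the bound dimension-free. -/
theorem integral_pow_four_multivariateGaussian {p : ℕ} (hp : 1 ≤ p) {M₁ M₂ : ℝ}
    {S : Matrix (Fin p) (Fin p) ℝ} (hS : S ∈ covSpace p M₁ M₂) :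
    Integrable (fun y : EuclideanSpace ℝ (Fin p) => ‖y‖ ^ 4 / (p : ℝ) ^ 2)
      (multivariateGaussian 0 S) ∧
    ∫ y, ‖y‖ ^ 4 / (p : ℝ) ^ 2 ∂(multivariateGaussian 0 S) ≤
      M₂ ^ 2 * ∫ z, z ^ 4 ∂(gaussianReal 0 1) := by
  have hp0 : (0 : ℝ) < p := by exact_mod_cast hp
  have hdiag : ∀ i, 0 ≤ S i i ∧ S i i ≤ M₂ := fun i => by
    refine ⟨hS.1.diag_nonneg, ?_⟩
    have := (covSpace_quadratic_bounds hS (EuclideanSpace.single i 1)).2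
    simpa using this
  have hmp : ∀ i, MeasurePreserving (fun x : EuclideanSpace ℝ (Fin p) => x i)
      (multivariateGaussian 0 S) ((gaussianReal 0 1).map fun z => √(S i i) * z) := fun i => by
    rw [← gaussianReal_eq_map_sqrt (hdiag i).1]
    exact measurePreserving_eval_multivariateGaussian hS.1
  have hpow : ∀ i z, (√(S i i) * z) ^ 4 = S i i ^ 2 * z ^ 4 := fun i z => by
    have := Real.sq_sqrt (hdiag i).1
    calc (√(S i i) * z) ^ 4 = (√(S i i) ^ 2) ^ 2 * z ^ 4 := by ring
      _ = _ := by rw [this]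
  have hint : ∀ i, Integrable (fun x : EuclideanSpace ℝ (Fin p) => x i ^ 4)
      (multivariateGaussian 0 S) := fun i => by
    refine (hmp i).integrable_comp_of_integrable (g := fun z : ℝ => z ^ 4) ?_
    rw [integrable_map_measure (by fun_prop) (by fun_prop)]
    simpa only [Function.comp_def, hpow] using (integrable_pow_gaussianReal 4).const_mul _
  have hval : ∀ i, ∫ x : EuclideanSpace ℝ (Fin p), x i ^ 4 ∂(multivariateGaussian 0 S) =
      S i i ^ 2 * ∫ z, z ^ 4 ∂(gaussianReal 0 1) := fun i => by
    have h := integral_map (μ := multivariateGaussian 0 S) (hmp i).measurable.aemeasurable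
      (f := fun z : ℝ => z ^ 4) (by fun_prop)
    rw [← h, (hmp i).map_eq, integral_map (by fun_prop) (by fun_prop)]
    simp only [hpow]
    exact integral_const_mul _ _
  have hle : ∀ y : EuclideanSpace ℝ (Fin p), ‖y‖ ^ 4 / (p : ℝ) ^ 2 ≤ (∑ i, y i ^ 4) / p := by
    intro y
    rw [div_le_div_iff₀ (by positivity) hp0]
    have h1 : ‖y‖ ^ 4 = (∑ i, y i ^ 2) ^ 2 := by
      rw [← EuclideanSpace.real_norm_sq_eq]; ring
    have h2 := sq_sum_le_card_mul_sum_sq (s := (Finset.univ : Finset (Fin p)))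
      (f := fun i => y i ^ 2)
    simp only [Finset.card_univ, Fintype.card_fin, ← pow_mul] at h2
    norm_num at h2
    rw [h1]
    nlinarith
  have hI : Integrable (fun y : EuclideanSpace ℝ (Fin p) => (∑ i, y i ^ 4) / (p : ℝ))
      (multivariateGaussian 0 S) := (integrable_finsetSum _ fun i _ => hint i).div_const _
  have hI2 : Integrable (fun y : EuclideanSpace ℝ (Fin p) => ‖y‖ ^ 4 / (p : ℝ) ^ 2)
      (multivariateGaussian 0 S) := by
    refine hI.mono' (by fun_prop) (Filter.Eventually.of_forall fun y => ?_)
    rw [Real.norm_eq_abs, abs_of_nonneg (by positivity)]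
    exact hle y
  refine ⟨hI2, (integral_mono hI2 hI hle).trans ?_⟩
  rw [integral_div, integral_finsetSum _ fun i _ => hint i]
  simp only [hval]
  rw [div_le_iff₀ hp0, ← Finset.sum_mul]
  have hm : 0 ≤ ∫ z, z ^ 4 ∂(gaussianReal 0 1) :=
    integral_nonneg fun z => by positivity
  have hs : ∑ i, S i i ^ 2 ≤ p * M₂ ^ 2 := by
    calc ∑ i, S i i ^ 2 ≤ ∑ _i : Fin p, M₂ ^ 2 :=
          Finset.sum_le_sum fun i _ => pow_le_pow_left₀ (hdiag i).1 (hdiag i).2 2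
      _ = p * M₂ ^ 2 := by simp
  calc _ ≤ p * M₂ ^ 2 * ∫ z, z ^ 4 ∂(gaussianReal 0 1) := mul_le_mul_of_nonneg_right hs hm
    _ = _ := by ring

/-- The spectral norm of a symmetric matrix is controlled by its quadratic form on unit vectors. -/
theorem specNorm_le {p : ℕ} {A : Matrix (Fin p) (Fin p) ℝ} (hA : A.IsHermitian) {c : ℝ}
    (hc : 0 ≤ c) (h : ∀ v : EuclideanSpace ℝ (Fin p), ‖v‖ = 1 → |v.ofLp ⬝ᵥ A.mulVec v.ofLp| ≤ c) :
    specNorm A ≤ c := by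
  have hsymm : (Matrix.toEuclideanCLM (n := Fin p) (𝕜 := ℝ) A).IsSymmetric := by
    rw [← ContinuousLinearMap.isSelfAdjoint_iff_isSymmetric]
    exact IsSelfAdjoint.map hA _
  rw [specNorm, ContinuousLinearMap.norm_eq_iSup_rayleighQuotient _ hsymm]
  refine ciSup_le fun x => ?_
  by_cases hx : x = 0
  · simpa [hx] using hc
  · have hx0 : ‖x‖ ≠ 0 := norm_ne_zero_iff.mpr hx
    rw [← ContinuousLinearMap.rayleigh_smul _ x (inv_ne_zero hx0)]
    have hv : ‖(‖x‖⁻¹ • x)‖ = 1 := by rw [norm_smul, norm_inv, norm_norm, inv_mul_cancel₀ hx0]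
    have := h _ hv
    rw [← Matrix.inner_toEuclideanCLM, real_inner_comm] at this
    simpa [ContinuousLinearMap.rayleighQuotient, ContinuousLinearMap.reApplyInnerSelf_apply, hv]
      using this

theorem integral_radOn_discriminators_le {p n : ℕ} (hp : 1 ≤ p) (hn : 1 ≤ n) {B M₁ M₂ : ℝ}
    (hB : 0 ≤ B) {d : ℕ → ℕ∞} (hd : ∀ l, 1 ≤ d l) (L : ℕ) {S : Matrix (Fin p) (Fin p) ℝ}
    (hS : S ∈ covSpace p M₁ M₂) :
    ∫ x : Fin n → EuclideanSpace ℝ (Fin p), radOn (discriminators p B d (L + 1)) x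
        ∂(Measure.pi fun _ => multivariateGaussian 0 S) ≤
      2 ^ L * (√(p / n) * (((77 + B) + (B + 8 * B ^ 4) *
        (M₂ ^ 2 * ∫ z, z ^ 4 ∂(gaussianReal 0 1))) * n)) := by
  have hne : Nonempty (discriminators p B d (L + 1)) :=
    ⟨⟨_, sigmoidNodes_subset_discriminators hd L ⟨0, 0, by simpa using hB, rfl⟩⟩⟩
  set Q := multivariateGaussian 0 S
  obtain ⟨hI, hle⟩ := integral_pow_four_multivariateGaussian hp hS
  have hmp : ∀ i, MeasurePreserving (Function.eval i) (Measure.pi fun _ : Fin n => Q) Q :=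
    fun i => measurePreserving_eval (fun _ : Fin n => Q) i
  have hi : ∀ i : Fin n, Integrable (fun x : Fin n → EuclideanSpace ℝ (Fin p) =>
      ‖x i‖ ^ 4 / (p : ℝ) ^ 2) (Measure.pi fun _ => Q) := fun i =>
    (hmp i).integrable_comp_of_integrable hI
  have hv : ∀ i : Fin n, ∫ x : Fin n → EuclideanSpace ℝ (Fin p), ‖x i‖ ^ 4 / (p : ℝ) ^ 2
      ∂(Measure.pi fun _ => Q) = ∫ y, ‖y‖ ^ 4 / (p : ℝ) ^ 2 ∂Q := fun i => by
    conv_rhs => rw [← (hmp i).map_eq]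
    rw [integral_map (hmp i).measurable.aemeasurable (by fun_prop)]
  have hsum : Integrable (fun x : Fin n → EuclideanSpace ℝ (Fin p) =>
      (B + 8 * B ^ 4) * ∑ i, ‖x i‖ ^ 4 / (p : ℝ) ^ 2) (Measure.pi fun _ => Q) :=
    (integrable_finsetSum _ fun i _ => hi i).const_mul _
  have hbound : Integrable (fun x : Fin n → EuclideanSpace ℝ (Fin p) =>
      2 ^ L * (√(p / n) * ((77 + B) * n + (B + 8 * B ^ 4) * ∑ i, ‖x i‖ ^ 4 / (p : ℝ) ^ 2)))
      (Measure.pi fun _ => Q) :=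
    (((integrable_const _).add hsum).const_mul _).const_mul _
  refine (integral_mono (integrable_radOn (by positivity)
    (discriminators_subset_boundedLip hB d L)) hbound fun x =>
      (radOn_discriminators_le hB d L x (rad_nonneg _)).trans
        (mul_le_mul_of_nonneg_left (radOn_sigmoidNodes_le hp hn hB x) (by positivity))).trans ?_
  rw [integral_const_mul, integral_const_mul, integral_add (integrable_const _) hsum,
    integral_const, integral_const_mul, integral_finsetSum _ fun i _ => hi i]
  simp only [hv, probReal_univ, one_smul, Finset.sum_const, Finset.card_univ,
    Fintype.card_fin, nsmul_eq_mul]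
  have h1 : (B + 8 * B ^ 4) * ((n : ℝ) * ∫ y, ‖y‖ ^ 4 / (p : ℝ) ^ 2 ∂Q) ≤
      (B + 8 * B ^ 4) * (n * (M₂ ^ 2 * ∫ z, z ^ 4 ∂(gaussianReal 0 1))) := by gcongr
  have h2 : (77 + B) * n + (B + 8 * B ^ 4) * (n * ∫ y, ‖y‖ ^ 4 / (p : ℝ) ^ 2 ∂Q) ≤
      ((77 + B) + (B + 8 * B ^ 4) * (M₂ ^ 2 * ∫ z, z ^ 4 ∂(gaussianReal 0 1))) * n := by
    refine (add_le_add_right h1 _).trans (le_of_eq ?_)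
    ring
  gcongr

/-! ### From deviation to spectral error, and the probability of the event -/

/-- A minimizer of the objective is close to the center in the quadratic form, if the empirical
means over the discriminators are close to the means under the center. -/
theorem specNorm_sub_le_of_isEstimate {p n : ℕ} {M₁ M₂ Δ : ℝ} (hM₁ : 0 < M₁)
    {D : Set (EuclideanSpace ℝ (Fin p) → ℝ)} {K : ℝ} (hD : D ⊆ boundedLip p K)
    (hsub : sigmoidNodes p (1 / M₁) ⊆ D) {S T : Matrix (Fin p) (Fin p) ℝ}
    (hS : S ∈ covSpace p M₁ M₂) {x : Fin n → EuclideanSpace ℝ (Fin p)}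
    (hT : IsEstimate D (covSpace p M₁ M₂) x T)
    (hdev : sampleDev D (multivariateGaussian 0 S) x ≤ Δ) :
    specNorm (T - S) ≤ 2 * Δ / ((∫ z, sigmoidGap (M₂ * (1 / M₁) ^ 2) z ∂(gaussianReal 0 1)) / 2 *
      (1 / M₁) ^ 2) := by
  set B := 1 / M₁ with hB
  have hB0 : 0 < B := by positivity
  have hne : Nonempty D := ⟨⟨_, hsub ⟨0, 0, by simpa using hB0.le, rfl⟩⟩⟩
  set κ := (∫ z, sigmoidGap (M₂ * B ^ 2) z ∂(gaussianReal 0 1)) / 2 with hκ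
  have hκ0 : 0 < κ := half_pos (integral_sigmoidGap_pos _)
  have hΔ0 : 0 ≤ Δ := (Real.iSup_nonneg fun _ => abs_nonneg _).trans hdev
  have hdevf : ∀ f ∈ D, |(∑ i, f (x i)) / n - ∫ y, f y ∂(multivariateGaussian 0 S)| ≤ Δ := by
    intro f hf
    have hb : BddAbove (Set.range fun f : D =>
        |(∑ i, f.1 (x i)) / n - ∫ y, f.1 y ∂(multivariateGaussian 0 S)|) :=
      bddAbove_range_of_abs_le (K := 2) fun f => by rw [abs_abs]; exact abs_dev_le_two hD f x
    exact (le_ciSup hb ⟨f, hf⟩).trans hdev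
  have hobjS : objective D x S ≤ Δ := ciSup_le fun f => (le_abs_self _).trans (hdevf f.1 f.2)
  have hobjT : objective D x T ≤ Δ := (hT.2 hS).trans hobjS
  -- Only one sign is available, since the objective is a supremum without absolute values.
  have hclose : ∀ f ∈ D, ∫ y, f y ∂(multivariateGaussian 0 S) -
      ∫ y, f y ∂(multivariateGaussian 0 T) ≤ 2 * Δ := by
    intro f hf
    have hb : BddAbove (Set.range fun f : D =>
        (∑ i, f.1 (x i)) / n - ∫ y, f.1 y ∂(multivariateGaussian 0 T)) :=
      bddAbove_range_of_abs_le (K := 2) fun f => abs_dev_le_two hD f x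
    have h1 := (le_ciSup hb ⟨f, hf⟩).trans hobjT
    have h2 := (abs_le.mp (hdevf f hf)).1
    simp only at h1
    linarith
  refine specNorm_le (hT.1.1.isHermitian.sub hS.1.isHermitian) (by positivity) fun v hv => ?_
  have hw : ‖B • v‖ = B := by rw [norm_smul, hv, mul_one, Real.norm_of_nonneg hB0.le]
  have hquad : ∀ A : Matrix (Fin p) (Fin p) ℝ,
      (B • v).ofLp ⬝ᵥ A.mulVec (B • v).ofLp = B ^ 2 * (v.ofLp ⬝ᵥ A.mulVec v.ofLp) := fun A => by
    simp only [WithLp.ofLp_smul, Matrix.mulVec_smul, dotProduct_smul, smul_dotProduct,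
      smul_eq_mul]
    ring
  -- The nodes in direction v with shifts 1 and -1 bound the difference of the means from both
  -- sides.
  have hs := hclose _ (hsub ⟨B • v, 1, hw.le, rfl⟩)
  have ht := hclose _ (hsub ⟨B • v, -1, hw.le, rfl⟩)
  simp only [integral_sigmoid_multivariateGaussian hS.1,
    integral_sigmoid_multivariateGaussian hT.1.1, sigmoidMean_neg_one] at hs ht
  have bS := covSpace_quadratic_bounds hS (B • v)
  have bT := covSpace_quadratic_bounds hT.1 (B • v)
  rw [hw] at bS bT
  have hMB : 0 ≤ M₁ * B ^ 2 := by positivity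
  have hkey : κ * |(B • v).ofLp ⬝ᵥ T.mulVec (B • v).ofLp -
      (B • v).ofLp ⬝ᵥ S.mulVec (B • v).ofLp| ≤ 2 * Δ := by
    rcases le_total ((B • v).ofLp ⬝ᵥ S.mulVec (B • v).ofLp)
      ((B • v).ofLp ⬝ᵥ T.mulVec (B • v).ofLp) with h | h
    · rw [abs_of_nonneg (by linarith)]
      have := sigmoidMean_separation (hMB.trans bS.1) h bT.2
      rw [← hκ] at this
      linarith
    · rw [abs_of_nonpos (by linarith), neg_sub]
      have := sigmoidMean_separation (hMB.trans bT.1) h bS.2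
      rw [← hκ] at this
      linarith
  rw [hquad, hquad, ← mul_sub, abs_mul, abs_of_pos (by positivity : 0 < B ^ 2)] at hkey
  rw [Matrix.sub_mulVec, dotProduct_sub, le_div_iff₀ (by positivity)]
  linarith

/-- A version of the bounded difference inequality for the deviation on a random sample, with a
measurable event inside a given almost sure one. -/
theorem exists_measurableSet_sampleDev_le {p n : ℕ} (hn : 1 ≤ n) {K : ℝ}
    {F : Set (EuclideanSpace ℝ (Fin p) → ℝ)} [Nonempty F] (hF : F ⊆ boundedLip p K)
    (P Q : Measure (EuclideanSpace ℝ (Fin p))) [IsProbabilityMeasure P] [IsProbabilityMeasure Q]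
    {Ω : Type*} [MeasurableSpace Ω] {μ : Measure Ω} [IsProbabilityMeasure μ]
    {X : Fin n → Ω → EuclideanSpace ℝ (Fin p)} (hX : iIndepFun X μ) (hP : ∀ i, HasLaw (X i) P μ)
    {G : Ω → Prop} (hG : ∀ᵐ ω ∂μ, G ω) {s : ℝ} (hs : 0 ≤ s) :
    ∃ A : Set Ω, MeasurableSet A ∧ 1 - Real.exp (-(n * s ^ 2 / 2)) ≤ μ.real A ∧
      ∀ ω ∈ A, G ω ∧ sampleDev F Q (fun i => X i ω) ≤
        ∫ x : Fin n → EuclideanSpace ℝ (Fin p), sampleDev F Q x ∂(Measure.pi fun _ => P) + s := by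
  have hn0 : (0 : ℝ) < n := by exact_mod_cast hn
  have hXm : AEMeasurable (fun ω i => X i ω) μ :=
    aemeasurable_pi_lambda _ fun i => (hP i).aemeasurable
  have hlaw : μ.map (fun ω i => X i ω) = Measure.pi fun _ => P := by
    rw [(iIndepFun_iff_map_fun_eq_pi_map fun i => (hP i).aemeasurable).mp hX]
    congr 1
    funext i
    exact (hP i).map_eq
  set I := ∫ x : Fin n → EuclideanSpace ℝ (Fin p), sampleDev F Q x ∂(Measure.pi fun _ => P)
  have hm := (continuous_sampleDev (n := n) (Q := Q) hF).measurable
  set bad : Set (Fin n → EuclideanSpace ℝ (Fin p)) := {x | s ≤ sampleDev F Q x - I} with hbad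
  have hbadm : MeasurableSet bad := measurableSet_le measurable_const (hm.sub_const _)
  have htail : (Measure.pi fun _ => P).real bad ≤ Real.exp (-(n * s ^ 2 / 2)) := by
    -- Replacing one observation changes the deviation by at most 2/n, so the variance proxy is
    -- n·(2/n)²/4 = 1/n.
    refine (measureReal_ge_le_of_bounded_differences P n (c := 2 / n) hm
      (fun x => abs_sampleDev_le hF x) (fun i x y h => sampleDev_sub_le hF i x y h) hs).trans
      (le_of_eq ?_)
    congr 1
    field_simp
    ring
  have hA0 : NullMeasurableSet ((fun ω i => X i ω) ⁻¹' badᶜ) μ :=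
    hXm.nullMeasurableSet_preimage hbadm.compl
  have hae : ((fun ω i => X i ω) ⁻¹' badᶜ ∩ {ω | G ω} : Set Ω) =ᵐ[μ]
      ((fun ω i => X i ω) ⁻¹' badᶜ : Set Ω) := by
    filter_upwards [hG] with ω hω
    exact propext ⟨fun h => h.1, fun h => ⟨h, hω⟩⟩
  -- The sample is only a.e. measurable and `G` arbitrary, so the event is merely null measurable; a
  -- measurable subset of full measure in it serves as `A`.
  obtain ⟨A, hAsub, hAm, hAeq⟩ := (hA0.congr hae.symm).exists_measurable_subset_ae_eq
  refine ⟨A, hAm, ?_, fun ω hω => ⟨(hAsub hω).2, ?_⟩⟩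
  · rw [measureReal_congr (hAeq.trans hae),
      ← map_measureReal_apply_of_aemeasurable hXm hbadm.compl, hlaw,
      probReal_compl_eq_one_sub hbadm]
    linarith
  · have h : ¬ s ≤ sampleDev F Q (fun i => X i ω) - I := (hAsub hω).1
    linarith

end WGAN

open WGAN in
/-- The constants: `c` is absolute, and `C` depends on `M₁` and `M₂` only. The contaminated
distribution is `P`, the data are `X 1, …, X n`, and "with probability at least" is expressed by a
measurable event `A` of that probability on which the bound holds, so that the estimator does not
have to be assumed measurable. -/
theorem theorem9 :
    ∃ c : ℝ, 0 < c ∧ ∀ M₁ M₂ : ℝ, 0 < M₁ → ∃ C : ℝ, 0 < C ∧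
      ∀ (p n L : ℕ) (ε : ℝ) (d : ℕ → ℕ∞),
        1 ≤ p → 1 ≤ n → 1 ≤ L → 0 ≤ ε → (∀ l, 1 ≤ d l) →
        2 ^ L * ((p : ℝ) / n) + ε ^ 2 ≤ c →
      ∀ Sstar ∈ WGAN.covSpace p M₁ M₂,
      ∀ (P : Measure (EuclideanSpace ℝ (Fin p))) [IsProbabilityMeasure P],
        WGAN.W1 P (multivariateGaussian 0 Sstar) ≤ ENNReal.ofReal ε →
      ∀ (Ω : Type*) [MeasurableSpace Ω] (μ : Measure Ω) [IsProbabilityMeasure μ]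
        (X : Fin n → Ω → EuclideanSpace ℝ (Fin p)),
        iIndepFun X μ → (∀ i, HasLaw (X i) P μ) →
      ∀ Shat : Ω → Matrix (Fin p) (Fin p) ℝ,
        (∀ᵐ ω ∂μ, WGAN.IsEstimate (WGAN.discriminators p (1 / M₁) d L)
          (WGAN.covSpace p M₁ M₂) (fun i => X i ω) (Shat ω)) →
      ∃ A : Set Ω, MeasurableSet A ∧
        1 - Real.exp (-((p : ℝ) + n * ε ^ 2)) ≤ μ.real A ∧
        ∀ ω ∈ A, WGAN.specNorm (Shat ω - Sstar) ≤ C * max (2 ^ L * √((p : ℝ) / n)) ε := by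
  refine ⟨1, one_pos, fun M₁ M₂ hM₁ => ?_⟩
  set B := 1 / M₁ with hB
  have hB0 : 0 < B := by positivity
  set κ := (∫ z, sigmoidGap (M₂ * B ^ 2) z ∂(gaussianReal 0 1)) / 2 with hκ
  have hκ0 : 0 < κ := half_pos (integral_sigmoidGap_pos _)
  set R := (77 + B) + (B + 8 * B ^ 4) * (M₂ ^ 2 * ∫ z, z ^ 4 ∂(gaussianReal 0 1)) with hR
  have hm4 : 0 ≤ ∫ z, z ^ 4 ∂(gaussianReal 0 1) := integral_nonneg fun z => by positivity
  have hR0 : 0 < R := by positivity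
  -- With m the maximum in the rate: `R` comes from the Rademacher average, B/2 from the coupling
  -- cost (B/4)(ε + δ) ≤ (B/4)·2m, and 4 from s ≤ 2δ + 2ε ≤ 4m.
  refine ⟨2 * (R + B / 2 + 4) / (κ * B ^ 2), by positivity, ?_⟩
  intro p n L ε d hp hn hL hε hd _ S hS P _ hW Ω _ μ _ X hX hP Shat hShat
  obtain ⟨L, rfl⟩ : ∃ k, L = k + 1 := ⟨L - 1, by omega⟩
  have hp0 : (0 : ℝ) < p := by exact_mod_cast hp
  have hn0 : (0 : ℝ) < n := by exact_mod_cast hn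
  have hD := discriminators_subset_boundedLip (p := p) hB0.le d L
  have hsub := sigmoidNodes_subset_discriminators (p := p) (B := B) hd L
  have hne : Nonempty (discriminators p B d (L + 1)) :=
    ⟨⟨_, hsub ⟨0, 0, by simpa using hB0.le, rfl⟩⟩⟩
  set δ := √((p : ℝ) / n) with hδ
  have hδ0 : 0 < δ := Real.sqrt_pos.mpr (by positivity)
  have hδ2 : δ ^ 2 = p / n := Real.sq_sqrt (by positivity)
  set m := max (2 ^ (L + 1) * δ) ε with hm
  have hm1 : 2 ^ (L + 1) * δ ≤ m := le_max_left _ _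
  have hm2 : ε ≤ m := le_max_right _ _
  have hm3 : δ ≤ m := (le_mul_of_one_le_left hδ0.le (one_le_pow₀ one_le_two)).trans hm1
  -- Chosen so that the exponent n s²/2 equals p + nε².
  set s := √(2 * δ ^ 2 + 2 * ε ^ 2) with hs
  have hs2 : s ^ 2 = 2 * δ ^ 2 + 2 * ε ^ 2 := Real.sq_sqrt (by positivity)
  have hsm : s ≤ 2 * δ + 2 * ε := Real.sqrt_le_iff.mpr ⟨by positivity, by nlinarith⟩
  obtain ⟨A, hAm, hAp, hA⟩ := exists_measurableSet_sampleDev_le hn hD P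
    (multivariateGaussian 0 S) hX hP hShat (Real.sqrt_nonneg (2 * δ ^ 2 + 2 * ε ^ 2))
  refine ⟨A, hAm, ?_, fun ω hω => ?_⟩
  · refine le_trans (le_of_eq ?_) hAp
    rw [← hs, hs2, hδ2]
    congr 3
    field_simp
  · obtain ⟨hest, hdev⟩ := hA ω hω
    have h1 := integral_sampleDev_le_of_W1 (by positivity) hD hn P hε hδ0 hW
    have h2 := integral_sampleDev_le (n := n) (Q := multivariateGaussian 0 S) (by positivity) hD hn
    have h3 := integral_radOn_discriminators_le hp hn hB0.le hd L hS
    rw [← hR] at h3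
    -- The layers give 2^L for depth L + 1; symmetrization supplies the remaining factor two.
    have h4 : 2 * (∫ x : Fin n → EuclideanSpace ℝ (Fin p),
        radOn (discriminators p B d (L + 1)) x
        ∂(Measure.pi fun _ => multivariateGaussian 0 S)) / n ≤ R * (2 ^ (L + 1) * δ) := by
      rw [div_le_iff₀ hn0, pow_succ]
      refine (mul_le_mul_of_nonneg_left h3 zero_le_two).trans (le_of_eq ?_)
      ring
    have h5 : R * (2 ^ (L + 1) * δ) ≤ R * m := mul_le_mul_of_nonneg_left hm1 hR0.le
    have h6 : B / 4 * (ε + δ) ≤ B / 4 * (2 * m) :=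
      mul_le_mul_of_nonneg_left (by linarith) (by positivity)
    have hdev' : sampleDev (discriminators p B d (L + 1)) (multivariateGaussian 0 S)
        (fun i => X i ω) ≤ (R + B / 2 + 4) * m := by
      refine hdev.trans ?_
      rw [← hs]
      linarith
    refine (specNorm_sub_le_of_isEstimate hM₁ hD hsub hS hest hdev').trans (le_of_eq ?_)
    rw [← hB, ← hκ]
    ring
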